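/- **Setting.** Let $f_Z$ be a base density on $\mathbb{R}$ with distribution function $F_Z$: $f_Z>0$, $\int f_Z=1$, $f_Z$ is log-concave and twice differentiable, with bounded first and second derivatives. Let $\Xi\subseteq\mathbb{R}$ be an open interval (the sample space), let $[\iota_l,\iota_u]\subseteq\Xi$ with $\iota_l<\iota_u$, and let $\boldsymbol a:\Xi\to\mathbb{R}^{M+1}$ be a continuously differentiable map which on $[\iota_l,\iota_u]$ is the Bernstein basis of order $M$, i.e. $a_m(y)=\binom{M}{m}\tilde y^{\,m}(1-\tilde y)^{M-m}$ with $\tilde y=(y-\iota_l)/(\iota_u-\iota_l)$. Let $\boldsymbol b:\mathcal{X}\to\mathbb{R}^{O}$ be measurable predictor terms on a feature space $\mathcal{X}$, and let $r_\beta:\mathcal{X}\to\mathbb{R}$, $\beta\in\mathbb{R}^q$, be a remainder term, measurable in the features and continuous in $\beta$. For a parameter $\theta=(\Gamma,\phi,\beta)\in\mathbb{R}^{(M+1)\times O}\times\mathbb{R}^p\times\mathbb{R}^q$ put $$h_{1}(y\mid x)=\boldsymbol a(y)^\top\Gamma\,\boldsymbol b(x),\qquad h_\theta(y\mid y_{-1},\dots,y_{-p},x)=h_1(y\mid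 x)+\sum_{j=1}^p\phi_j\,h_1(y_{-j}\mid x)+r_\beta(x).$$ The model is called *feature-free* if $O=1$, $\boldsymbol b\equiv1$, $q=0$ and $r\equiv0$. Let $\Theta$ be a compact set of parameters such that $\partial h_1(y\mid x)/\partial y>0$ for all $\theta\in\Theta$, $y\in\Xi$, $x\in\mathcal{X}$, and let $\theta^*$ be an interior point of $\Theta$. Let $(Y_t)_{t\ge1}$ be a $\Xi$-valued series with features $(X_t)_{t\ge1}$ in $\mathcal{X}$. Say that the series *follows the AT($p$) model with parameter $\theta$* if, for all $t>p$ and $y\in\Xi$, almost surely $$\mathbb{P}(Y_t\le y\mid Y_{t-1},\dots,Y_1,X_t,\dots,X_1)=F_Z\bigl(h_\theta(y\mid Y_{t-1},\dots,Y_{t-p},X_t)\bigr).$$ Given starting values $\mathcal{Y}_0=(y_0,\dots,y_{-p+1})$, put $Y_s=y_s$ for $s\le0$ in the lags of the log-likelihood $$\ell_T(\theta)=\sum_{t=1}^T\Bigl\{\log f_Z\bigl(h_\theta(Y_t\mid Y_{t-1},\dots,Y_{t-p},X_t)\bigr)+\log\Bigl|\tfrac{\partial}{\partial y}h_\theta(y\mid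 Y_{t-1},\dots,Y_{t-p},X_t)\big|_{y=Y_t}\Bigr|\Bigr\},$$ and let $\hat\theta_T\in\arg\min_{\theta\in\Theta}\{-\ell_T(\theta)\}$ be any maximum-likelihood estimator. **Theorem 1 (Consistency).** Suppose that the series follows the AT($p$) model with the true parameter $\theta^*$, that the elements of $\mathcal{Y}_0$ are finite, and that the series is strictly stationary and ergodic (jointly with the features, if there are any). If the model is not feature-free, suppose also that $\theta^*$ is unique, i.e. that the series does not follow the AT($p$) model with any other parameter $\theta\in\Theta$. Then $\hat\theta_T\to\theta^*$ almost surely as $T\to\infty$. -/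

import Mathlib

open MeasureTheory Filter Topology

noncomputable section

/-- `f` is the density of an admissible base (error) distribution: a positive probability density on
the real line which is log-concave and twice differentiable, with bounded first and second
derivatives. -/
structure IsBaseDensity (f : ℝ → ℝ) : Prop where
  pos : ∀ z, 0 < f z
  integrable : Integrable f
  integral_eq_one : ∫ z, f z = 1
  logConcave : ConcaveOn ℝ Set.univ fun z => Real.log (f z)
  differentiable : Differentiable ℝ f
  differentiable_deriv : Differentiable ℝ (deriv f)
  bounded_deriv : ∃ C, ∀ z, |deriv f z| ≤ C
  bounded_deriv_deriv : ∃ C, ∀ z, |deriv (deriv f) z| ≤ C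

/-- The Bernstein basis of order `M` on `[lo, hi]`: its `m`-th entry is
`(M choose m) * s ^ m * (1 - s) ^ (M - m)` with `s = (y - lo) / (hi - lo)`, that is, the density of
the Beta distribution with parameters `m + 1`, `M - m + 1` at `s`, divided by `M + 1`. -/
def bernsteinBasis (M : ℕ) (lo hi y : ℝ) (m : Fin (M + 1)) : ℝ :=
  (bernsteinPolynomial ℝ M m).eval ((y - lo) / (hi - lo))

/-- The fixed (untrained) ingredients of an AT model: the base density `f`, the sample space `Ξ`
(an open interval), the outcome basis `a`, which is the Bernstein basis of order `M` on the interval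
`[lo, hi] ⊆ Ξ` and continuously differentiable on `Ξ`, the predictor terms `b` (all terms stacked
into one vector), and the parametric family `r` of exogenous remainder terms. -/
structure ATModel (M O q : ℕ) (𝒳 : Type*) [MeasurableSpace 𝒳] where
  f : ℝ → ℝ
  isBaseDensity : IsBaseDensity f
  Ξ : Set ℝ
  isOpen_Ξ : IsOpen Ξ
  ordConnected_Ξ : Ξ.OrdConnected
  lo : ℝ
  hi : ℝ
  lo_lt_hi : lo < hi
  Icc_subset : Set.Icc lo hi ⊆ Ξ
  a : ℝ → Fin (M + 1) → ℝ
  a_eq : ∀ y ∈ Set.Icc lo hi, a y = bernsteinBasis M lo hi y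
  contDiffOn_a : ContDiffOn ℝ 1 a Ξ
  b : 𝒳 → Fin O → ℝ
  measurable_b : Measurable b
  r : (Fin q → ℝ) → 𝒳 → ℝ
  measurable_r : ∀ β, Measurable (r β)
  continuous_r : ∀ x, Continuous fun β => r β x

/-- The parameters `θ = (Γ, φ, β)` of an AT(`p`) model: the weights of the basis coefficients, the
autoregressive coefficients, and the parameters of the remainder term. -/
abbrev ATParam (M O q p : ℕ) : Type :=
  Matrix (Fin (M + 1)) (Fin O) ℝ × (Fin p → ℝ) × (Fin q → ℝ)

namespace ATModel

variable {M O q p : ℕ} {𝒳 : Type*} [MeasurableSpace 𝒳] {Ω : Type*} [MeasurableSpace Ω]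

/-- The distribution function of the base distribution. -/
def baseCDF (A : ATModel M O q 𝒳) (z : ℝ) : ℝ := ∫ s in Set.Iic z, A.f s

/-- The basis coefficients `ϑ(x) = Γ b(x)`. -/
def coeff (A : ATModel M O q 𝒳) (θ : ATParam M O q p) (x : 𝒳) : Fin (M + 1) → ℝ :=
  Matrix.mulVec θ.1 (A.b x)

/-- The transformation `h₁(y | x) = a(y)ᵀ ϑ(x)`. -/
def h₁ (A : ATModel M O q 𝒳) (θ : ATParam M O q p) (x : 𝒳) (y : ℝ) : ℝ :=
  ∑ m, A.a y m * A.coeff θ x m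

/-- The shift `h₂ = ∑ⱼ φⱼ h₁(yₜ₋ⱼ | x) + r(x)`; `lags i` is the lag of order `i + 1`. -/
def h₂ (A : ATModel M O q 𝒳) (θ : ATParam M O q p) (x : 𝒳) (lags : Fin p → ℝ) : ℝ :=
  ∑ i, θ.2.1 i * A.h₁ θ x (lags i) + A.r θ.2.2 x

/-- The transformation function `h = h₁ + h₂` of the AT(`p`) model. -/
def h (A : ATModel M O q 𝒳) (θ : ATParam M O q p) (x : 𝒳) (lags : Fin p → ℝ) (y : ℝ) : ℝ :=
  A.h₁ θ x y + A.h₂ θ x lags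

/-- The transformation is increasing in the outcome, with positive derivative on the sample space
(so that the log-likelihood is finite). -/
def IsIncreasing (A : ATModel M O q 𝒳) (θ : ATParam M O q p) : Prop :=
  ∀ x, ∀ y ∈ A.Ξ, 0 < deriv (A.h₁ θ x) y

/-- The model does not use features: `ϑ(x)` is a free constant vector and `r = 0`. -/
def NoFeatures (A : ATModel M O q 𝒳) : Prop :=
  O = 1 ∧ (∀ x o, A.b x o = 1) ∧ q = 0 ∧ ∀ β x, A.r β x = 0

end ATModel

/-- The `p` lags of the observation `y t`. Here `y 0, y 1, …` are the observations at the times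
`1, 2, …`, and `y₀ i` is the starting value at time `-i`, for `i = 0, …, p - 1`. -/
def lagVector {p : ℕ} (y₀ : Fin p → ℝ) (y : ℕ → ℝ) (t : ℕ) (i : Fin p) : ℝ :=
  if (i : ℕ) < t then y (t - 1 - i) else y₀ ⟨i - t, by omega⟩

/-- The σ-algebra generated by the observations before `t` and the features up to `t`. -/
abbrev history {Ω 𝒳 : Type*} [MeasurableSpace 𝒳] (Y : ℕ → Ω → ℝ) (X : ℕ → Ω → 𝒳) (t : ℕ) :
    MeasurableSpace Ω :=
  (⨆ s : ℕ, ⨆ _ : s < t, MeasurableSpace.comap (Y s) inferInstance) ⊔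
    ⨆ s : ℕ, ⨆ _ : s ≤ t, MeasurableSpace.comap (X s) inferInstance

/-- A (measurable) process is strictly stationary and ergodic: the shift preserves its law on the
sequence space, and every shift-invariant event has probability zero or one. -/
def IsStationaryErgodic {Ω S : Type*} [MeasurableSpace Ω] [MeasurableSpace S]
    (Z : ℕ → Ω → S) (μ : Measure Ω) : Prop :=
  Ergodic (fun (z : ℕ → S) (n : ℕ) => z (n + 1)) (μ.map fun ω n => Z n ω)

namespace ATModel

variable {M O q p : ℕ} {𝒳 : Type*} [MeasurableSpace 𝒳] {Ω : Type*} [MeasurableSpace Ω]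

/-- The series follows the AT(`p`) model with parameter `θ`: the conditional distribution function
of each observation whose `p` lags belong to the series is `F_Z (h (y | lags, features))`. -/
def IsTrueParam (A : ATModel M O q 𝒳) (μ : Measure Ω) (Y : ℕ → Ω → ℝ) (X : ℕ → Ω → 𝒳)
    (θ : ATParam M O q p) : Prop :=
  ∀ t, p ≤ t → ∀ y ∈ A.Ξ,
    μ[Set.indicator {ω | Y t ω ≤ y} (fun _ => (1 : ℝ)) | history Y X t] =ᵐ[μ]
      fun ω => A.baseCDF (A.h θ (X t ω) (fun i : Fin p => Y (t - 1 - i) ω) y)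

/-- The log-likelihood of the first `T` observations given the starting values `y₀`. -/
def logLik (A : ATModel M O q 𝒳) (y₀ : Fin p → ℝ) (y : ℕ → ℝ) (x : ℕ → 𝒳) (T : ℕ)
    (θ : ATParam M O q p) : ℝ :=
  ∑ t ∈ Finset.range T,
    (Real.log (A.f (A.h θ (x t) (lagVector y₀ y t) (y t))) +
      Real.log |deriv (A.h θ (x t) (lagVector y₀ y t)) (y t)|)

/-- `θ` minimises the negative log-likelihood of the first `T` observations over `Θ`. -/
def IsMLE (A : ATModel M O q 𝒳) (Θ : Set (ATParam M O q p)) (y₀ : Fin p → ℝ) (y : ℕ → ℝ)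
    (x : ℕ → 𝒳) (T : ℕ) (θ : ATParam M O q p) : Prop :=
  θ ∈ Θ ∧ IsMinOn (fun θ' => -A.logLik y₀ y x T θ') Θ θ

end ATModel

end

/-! This is Wald's consistency argument, run on square roots of likelihood ratios. After the first
`p` observations every log-likelihood term is one fixed function of a window (features, lags,
outcome), and the windows are stationary and inherit ergodicity from the series. Let R be the ratio
of the conditional density under a competing parameter θ to that under θ*. Then log R = 2 log √R ≤
2(√R - 1), and under the true law √R has mean below one unless the two parameters give the same
transformation (`lintegral_sqrtRatio_lt_one`).

The square root makes the bound uniform in θ. Since θ* is interior and slopes are linear in Γ, all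
slopes over Θ are at most a constant times the slope at θ* (`exists_slope_le`); as `f` is bounded,
√R ≤ const / √f(Z), where Z is the latent value of the outcome under θ*. Z has density `f`, so the
bound has mean at most const · ∫ √f, which is finite because log-concave densities decay
exponentially. By dominated convergence, a function dominating √R on a whole neighbourhood of θ
still has mean below one (`exists_isOpen_lintegral_lt_one`). Birkhoff sums of a function with
negative mean tend to -∞, so the estimator eventually leaves that neighbourhood, and compactness of
Θ finishes the proof.

It remains to see that θ ≠ θ* changes the transformation. With features this is the uniqueness
hypothesis. Without them, equal transformations force h₁ to differ by a constant c and yield a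
linear relation between the transformed lags. The outcome has no atoms given the past, so the
relation is trivial and φ = φ*; then c(1 + ∑φ*) = 0. Finally 1 + ∑φ* ≠ 0: otherwise Z would be an
increment V' - V of a stationary sequence with V independent of Z, which characteristic functions
exclude. -/

noncomputable section

/-! ### Sums along an ergodic transformation -/

section Ergodic

variable {α : Type*} {T : α → α} {g : α → ℝ}

/-- The maximum of the Birkhoff sums of `g` of length at most `n` (the empty sum included). -/
def maxBirkhoffSum (T : α → α) (g : α → ℝ) : ℕ → α → ℝ
  | 0 => fun _ => 0
  | n + 1 => fun x => max 0 (g x + maxBirkhoffSum T g n (T x))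

theorem maxBirkhoffSum_nonneg (n : ℕ) (x : α) : 0 ≤ maxBirkhoffSum T g n x := by
  cases n with
  | zero => exact le_rfl
  | succ n => exact le_max_left _ _

theorem maxBirkhoffSum_le_succ (n : ℕ) (x : α) :
    maxBirkhoffSum T g n x ≤ maxBirkhoffSum T g (n + 1) x := by
  induction n generalizing x with
  | zero => exact maxBirkhoffSum_nonneg _ _
  | succ n ih => exact max_le_max le_rfl (add_le_add le_rfl (ih (T x)))

theorem monotone_maxBirkhoffSum (x : α) : Monotone fun n => maxBirkhoffSum T g n x :=
  monotone_nat_of_le_succ fun n => maxBirkhoffSum_le_succ n x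

theorem birkhoffSum_le_maxBirkhoffSum (n : ℕ) (x : α) :
    birkhoffSum T g n x ≤ maxBirkhoffSum T g n x := by
  induction n generalizing x with
  | zero => simp [maxBirkhoffSum]
  | succ n ih =>
    rw [birkhoffSum_succ']
    exact (add_le_add le_rfl (ih (T x))).trans (le_max_right _ _)

/-- Moving one step along the orbit changes the sums by the single term `g x`. The set of bounded
orbits is therefore invariant, and ergodicity applies to it. -/
theorem bddAbove_maxBirkhoffSum_comp_iff (x : α) :
    BddAbove (Set.range fun n => maxBirkhoffSum T g n (T x)) ↔
      BddAbove (Set.range fun n => maxBirkhoffSum T g n x) := by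
  constructor
  · rintro ⟨C, hC⟩
    refine ⟨max 0 (g x + C), ?_⟩
    rintro _ ⟨n, rfl⟩
    refine (maxBirkhoffSum_le_succ n x).trans ?_
    exact max_le_max le_rfl (add_le_add le_rfl (hC ⟨n, rfl⟩))
  · rintro ⟨C, hC⟩
    refine ⟨C - g x, ?_⟩
    rintro _ ⟨n, rfl⟩
    have h1 : maxBirkhoffSum T g (n + 1) x ≤ C := hC ⟨n + 1, rfl⟩
    have h2 : g x + maxBirkhoffSum T g n (T x) ≤ maxBirkhoffSum T g (n + 1) x := le_max_right _ _
    dsimp only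
    linarith

variable [MeasurableSpace α] {ν : Measure α}

theorem measurable_maxBirkhoffSum (hT : Measurable T) (hg : Measurable g) (n : ℕ) :
    Measurable (maxBirkhoffSum T g n) := by
  induction n with
  | zero => exact measurable_const
  | succ n ih => exact measurable_const.max (hg.add (ih.comp hT))

theorem integrable_maxBirkhoffSum (hT : MeasurePreserving T ν ν) (hg : Integrable g ν) (n : ℕ) :
    Integrable (maxBirkhoffSum T g n) ν := by
  induction n with
  | zero => exact integrable_zero _ _ _
  | succ n ih =>
    have h := (hg.add (hT.integrable_comp_of_integrable ih)).pos_part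
    refine h.congr (Eventually.of_forall fun x => ?_)
    simp [maxBirkhoffSum, max_comm]

/-- The maximal ergodic inequality. -/
theorem integral_indicator_maxBirkhoffSum_nonneg (hT : MeasurePreserving T ν ν)
    (hgm : Measurable g) (hg : Integrable g ν) (n : ℕ) :
    0 ≤ ∫ x, Set.indicator {x | 0 < maxBirkhoffSum T g n x} g x ∂ν := by
  have hM := integrable_maxBirkhoffSum hT hg n
  have hMm := measurable_maxBirkhoffSum hT.measurable hgm n
  have hMT := hT.integrable_comp_of_integrable hM
  -- Write M for the maximal sum. M - M ∘ T has integral zero by invariance; it is at most `g` where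
  -- M > 0, since there M = g + (shorter maximum) ∘ T, and nonpositive where M = 0.
  have h0 : ∫ x, (maxBirkhoffSum T g n x - maxBirkhoffSum T g n (T x)) ∂ν = 0 := by
    rw [integral_sub (g := fun x => maxBirkhoffSum T g n (T x)) hM hMT]
    have : ∫ x, maxBirkhoffSum T g n (T x) ∂ν = ∫ x, maxBirkhoffSum T g n x ∂ν := by
      conv_rhs => rw [← hT.map_eq]
      rw [integral_map hT.measurable.aemeasurable hMm.aestronglyMeasurable]
    rw [this, sub_self]
  refine h0.symm.le.trans
    (integral_mono (hM.sub hMT) (hg.indicator (measurableSet_lt measurable_const hMm)) ?_)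
  intro x
  by_cases hx : 0 < maxBirkhoffSum T g n x
  · rw [Set.indicator_of_mem (s := {x | 0 < maxBirkhoffSum T g n x}) hx]
    dsimp only [Pi.sub_apply, Function.comp_apply]
    cases n with
    | zero => exact absurd hx (lt_irrefl _)
    | succ n =>
      have h1 : maxBirkhoffSum T g (n + 1) x = g x + maxBirkhoffSum T g n (T x) := by
        rcases max_choice 0 (g x + maxBirkhoffSum T g n (T x)) with h | h
        · exact absurd (show maxBirkhoffSum T g (n + 1) x = 0 from h) hx.ne'
        · exact h
      have h2 := maxBirkhoffSum_le_succ (T := T) (g := g) n (T x)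
      linarith
  · rw [Set.indicator_of_notMem (s := {x | 0 < maxBirkhoffSum T g n x}) hx]
    dsimp only [Pi.sub_apply, Function.comp_apply]
    have h1 := maxBirkhoffSum_nonneg (T := T) (g := g) n x
    have h2 := maxBirkhoffSum_nonneg (T := T) (g := g) n (T x)
    linarith

theorem measurableSet_bddAbove_maxBirkhoffSum (hT : Measurable T) (hg : Measurable g) :
    MeasurableSet {x | BddAbove (Set.range fun n => maxBirkhoffSum T g n x)} := by
  have : {x | BddAbove (Set.range fun n => maxBirkhoffSum T g n x)} =
      ⋃ K : ℕ, ⋂ n, {x | maxBirkhoffSum T g n x ≤ K} := by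
    ext x
    simp only [Set.mem_ofPred_eq, Set.mem_iUnion, Set.mem_iInter]
    constructor
    · rintro ⟨C, hC⟩
      obtain ⟨K, hK⟩ := exists_nat_ge C
      exact ⟨K, fun n => (hC ⟨n, rfl⟩).trans hK⟩
    · rintro ⟨K, hK⟩
      refine ⟨K, ?_⟩
      rintro _ ⟨n, rfl⟩
      exact hK n
  rw [this]
  exact MeasurableSet.iUnion fun K => MeasurableSet.iInter fun n =>
    measurableSet_le (measurable_maxBirkhoffSum hT hg n) measurable_const

/-- By ergodicity the alternative is that the sums are almost surely unbounded. Then the sets in the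
maximal inequality exhaust the space, and its limit reads 0 ≤ ∫ g, a contradiction. -/
theorem ae_bddAbove_maxBirkhoffSum (hT : Ergodic T ν) (hgm : Measurable g) (hg : Integrable g ν)
    (hneg : ∫ x, g x ∂ν < 0) :
    ∀ᵐ x ∂ν, BddAbove (Set.range fun n => maxBirkhoffSum T g n x) := by
  set A := {x | BddAbove (Set.range fun n => maxBirkhoffSum T g n x)} with hA
  have hAm : MeasurableSet A := measurableSet_bddAbove_maxBirkhoffSum hT.measurable hgm
  have hinv : T ⁻¹' A = A := by
    ext x
    exact bddAbove_maxBirkhoffSum_comp_iff x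
  rcases hT.toPreErgodic.ae_mem_or_ae_notMem hAm hinv with h | h
  · exact h
  · exfalso
    have hlim : Tendsto (fun n => ∫ x, Set.indicator {x | 0 < maxBirkhoffSum T g n x} g x ∂ν)
        atTop (𝓝 (∫ x, g x ∂ν)) := by
      refine tendsto_integral_of_dominated_convergence (fun x => ‖g x‖) (fun n => ?_) hg.norm
        (fun n => Eventually.of_forall fun x => ?_) ?_
      · exact (hg.indicator (measurableSet_lt measurable_const
          (measurable_maxBirkhoffSum hT.measurable hgm n))).aestronglyMeasurable
      · exact norm_indicator_le_norm_self _ _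
      · filter_upwards [h] with x hx
        have : ∃ n, 0 < maxBirkhoffSum T g n x := by
          by_contra! hcon
          exact hx ⟨0, by rintro _ ⟨n, rfl⟩; exact hcon n⟩
        obtain ⟨n, hn⟩ := this
        refine tendsto_const_nhds.congr' ?_
        filter_upwards [eventually_ge_atTop n] with m hm
        have : 0 < maxBirkhoffSum T g m x := hn.trans_le (monotone_maxBirkhoffSum x hm)
        simp [Set.indicator, this]
    have := ge_of_tendsto' hlim
      (fun n => integral_indicator_maxBirkhoffSum_nonneg hT.toMeasurePreserving hgm hg n)
    linarith

/-- The Birkhoff sums of a function with negative mean tend to `-∞`. -/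
theorem ae_tendsto_birkhoffSum_atBot [IsProbabilityMeasure ν] (hT : Ergodic T ν)
    (hgm : Measurable g) (hg : Integrable g ν) (hneg : ∫ x, g x ∂ν < 0) :
    ∀ᵐ x ∂ν, Tendsto (fun n => birkhoffSum T g n x) atTop atBot := by
  -- Half of the gap: `g + ε` still has negative mean, so its sums are bounded above by some C, and
  -- those of `g` by C - nε.
  set ε := -(∫ x, g x ∂ν) / 2 with hε
  have hε0 : 0 < ε := by linarith
  have h := ae_bddAbove_maxBirkhoffSum (g := fun x => g x + ε) hT (hgm.add_const _)
    (hg.add (integrable_const _)) (by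
      rw [integral_add hg (integrable_const _)]
      simp
      linarith)
  filter_upwards [h] with x hx
  obtain ⟨C, hC⟩ := hx
  have hsum : ∀ n : ℕ, birkhoffSum T (fun x => g x + ε) n x = birkhoffSum T g n x + n * ε := by
    intro n
    simp [birkhoffSum, Finset.sum_add_distrib]
  have hb : ∀ n : ℕ, birkhoffSum T g n x ≤ C + -(n * ε) := by
    intro n
    have h1 := (birkhoffSum_le_maxBirkhoffSum (T := T) (g := fun x => g x + ε) n x).trans
      (hC ⟨n, rfl⟩)
    rw [hsum] at h1
    linarith
  refine tendsto_atBot_mono hb (tendsto_atBot_add_const_left _ _ ?_)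
  exact tendsto_neg_atTop_atBot.comp
    (tendsto_natCast_atTop_atTop.atTop_mul_const hε0)

end Ergodic

/-! ### Log-concave densities -/

namespace IsBaseDensity

variable {f : ℝ → ℝ}

theorem comp_neg (hf : ConcaveOn ℝ Set.univ fun z => Real.log (f z)) :
    ConcaveOn ℝ Set.univ fun z => Real.log (f (-z)) := by
  have := hf.comp_linearMap (-LinearMap.id : ℝ →ₗ[ℝ] ℝ)
  simpa [Function.comp_def] using this

/-- Integrability forces `f` to drop below `f 0` at some z₁ > 0. By concavity, log f beyond z₁ stays
below the line through its values at 0 and z₁, whose slope is -c. -/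
theorem exists_right_decay (hpos : ∀ z, 0 < f z) (hint : Integrable f)
    (hconc : ConcaveOn ℝ Set.univ fun z => Real.log (f z)) :
    ∃ c > 0, ∃ z₁ > 0, ∀ z ≥ z₁, f z ≤ f 0 * Real.exp (-c * z) := by
  obtain ⟨z₁, hz₁, hlt⟩ : ∃ z₁ > 0, f z₁ < f 0 := by
    by_contra! hcon
    have h1 : IntegrableOn (fun _ => f 0) (Set.Ioi (0 : ℝ)) := by
      refine Integrable.mono (hint.integrableOn (s := Set.Ioi 0)) aestronglyMeasurable_const ?_
      filter_upwards [ae_restrict_mem measurableSet_Ioi] with z hz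
      rw [Real.norm_of_nonneg (hpos _).le, Real.norm_of_nonneg (hpos _).le]
      exact hcon z hz
    have := (integrableOn_const_iff).1 h1
    rcases this with h | h
    · exact (hpos 0).ne' (by simpa using h)
    · simp at h
  refine ⟨(Real.log (f 0) - Real.log (f z₁)) / z₁,
    div_pos (sub_pos.2 (Real.log_lt_log (hpos _) hlt)) hz₁, z₁, hz₁, fun z hz => ?_⟩
  have hz0 : 0 < z := lt_of_lt_of_le hz₁ hz
  have hz1 : z₁ / z ≤ 1 := (div_le_one hz0).2 hz
  have hc := hconc.2 (Set.mem_univ 0) (Set.mem_univ z) (show 0 ≤ 1 - z₁ / z by linarith)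
    (show 0 ≤ z₁ / z by positivity) (by ring)
  have hz' : (1 - z₁ / z) • (0 : ℝ) + (z₁ / z) • z = z₁ := by
    simp; field_simp
  rw [hz'] at hc
  simp only [smul_eq_mul] at hc
  rw [← Real.log_le_log_iff (hpos _) (by have := hpos 0; positivity),
    Real.log_mul (hpos 0).ne' (Real.exp_pos _).ne', Real.log_exp]
  have h3 : (1 - z₁ / z) * Real.log (f 0) + z₁ / z * Real.log (f z) =
    Real.log (f 0) + z₁ / z * (Real.log (f z) - Real.log (f 0)) := by ring
  rw [h3] at hc
  have h4 : Real.log (f z) - Real.log (f 0) ≤ (Real.log (f z₁) - Real.log (f 0)) * (z / z₁) := by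
    have : Real.log (f z) - Real.log (f 0) =
        (z₁ / z * (Real.log (f z) - Real.log (f 0))) * (z / z₁) := by field_simp
    rw [this]
    exact mul_le_mul_of_nonneg_right (by linarith) (by positivity)
  have h5 : (Real.log (f z₁) - Real.log (f 0)) * (z / z₁) =
    -((Real.log (f 0) - Real.log (f z₁)) / z₁) * z := by ring
  linarith

theorem exists_decay (hf : IsBaseDensity f) :
    ∃ c > 0, ∃ C > 0, ∀ z, f z ≤ C * Real.exp (-c * |z|) := by
  obtain ⟨c₁, hc₁, z₁, hz₁, h₁⟩ := exists_right_decay hf.pos hf.integrable hf.logConcave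
  obtain ⟨c₂, hc₂, z₂, hz₂, h₂⟩ := exists_right_decay (f := fun z => f (-z))
    (fun z => hf.pos _) hf.integrable.comp_neg (comp_neg hf.logConcave)
  obtain ⟨B, hB⟩ := (isCompact_Icc (a := -z₂) (b := z₁)).bddAbove_image
    (f := fun z => f z * Real.exp (min c₁ c₂ * |z|))
    (by have := hf.differentiable.continuous; fun_prop)
  have hc : 0 < min c₁ c₂ := lt_min hc₁ hc₂
  have hexp : ∀ z, Real.exp (-min c₁ c₂ * |z|) * Real.exp (min c₁ c₂ * |z|) = 1 := by
    intro z; rw [← Real.exp_add]; simp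
  have h0 := hf.pos 0
  refine ⟨min c₁ c₂, hc, max B (f 0), lt_max_of_lt_right h0, fun z => ?_⟩
  rcases le_total z₁ z with hz | hz
  · have hz0 : 0 ≤ z := hz₁.le.trans hz
    rw [abs_of_nonneg hz0]
    refine (h₁ z hz).trans (mul_le_mul (le_max_right _ _) (Real.exp_le_exp.2 ?_)
      (Real.exp_pos _).le (lt_max_of_lt_right h0).le)
    exact mul_le_mul_of_nonneg_right (neg_le_neg (min_le_left _ _)) hz0
  rcases le_total z (-z₂) with hz' | hz'
  · have hz0 : z ≤ 0 := by linarith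
    have := h₂ (-z) (by linarith)
    simp only [neg_neg, neg_zero] at this
    rw [abs_of_nonpos hz0]
    refine this.trans (mul_le_mul (le_max_right _ _) (Real.exp_le_exp.2 ?_)
      (Real.exp_pos _).le (lt_max_of_lt_right h0).le)
    exact mul_le_mul_of_nonneg_right (neg_le_neg (min_le_right _ _)) (neg_nonneg.2 hz0)
  · have := hB ⟨z, ⟨hz', hz⟩, rfl⟩
    dsimp only at this
    calc f z = f z * Real.exp (min c₁ c₂ * |z|) * Real.exp (-min c₁ c₂ * |z|) := by
          rw [mul_assoc, mul_comm (Real.exp (min c₁ c₂ * |z|)), hexp, mul_one]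
      _ ≤ max B (f 0) * Real.exp (-min c₁ c₂ * |z|) := by
          gcongr
          exact this.trans (le_max_left _ _)

theorem exists_le (hf : IsBaseDensity f) : ∃ C > 0, ∀ z, f z ≤ C := by
  obtain ⟨c, hc, C, hC, h⟩ := hf.exists_decay
  refine ⟨C, hC, fun z => (h z).trans ?_⟩
  refine mul_le_of_le_one_right hC.le (Real.exp_le_one_iff.2 ?_)
  have := abs_nonneg z
  nlinarith

theorem continuous (hf : IsBaseDensity f) : Continuous f := hf.differentiable.continuous

/-- If Z has density `f`, this integral is the mean of 1 / √f(Z), which will dominate the square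
roots of all likelihood ratios. -/
theorem integrable_sqrt (hf : IsBaseDensity f) : Integrable fun z => √(f z) := by
  obtain ⟨c, hc, C, hC, h⟩ := hf.exists_decay
  have hi : Integrable fun z : ℝ => √C * Real.exp (-(c / 2) * |z|) := by
    refine Integrable.const_mul ?_ _
    have hpos : IntegrableOn (fun z : ℝ => Real.exp (-(c / 2) * |z|)) (Set.Ioi 0) :=
      (exp_neg_integrableOn_Ioi 0 (half_pos hc)).congr_fun
        (fun z hz => by rw [abs_of_pos hz]) measurableSet_Ioi
    have hneg : IntegrableOn (fun z : ℝ => Real.exp (-(c / 2) * |z|)) (Set.Iic 0) := by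
      refine (integrableOn_exp_mul_Iic (half_pos hc) 0).congr_fun
        (fun z hz => ?_) measurableSet_Iic
      rw [abs_of_nonpos hz, neg_mul_neg]
    rw [← integrableOn_univ, ← Set.Iic_union_Ioi (a := (0 : ℝ))]
    exact hneg.union hpos
  refine hi.mono (by have := hf.continuous; fun_prop) (Eventually.of_forall fun z => ?_)
  rw [Real.norm_of_nonneg (Real.sqrt_nonneg _), Real.norm_of_nonneg (by positivity)]
  rw [Real.sqrt_le_left (by positivity), mul_pow, Real.sq_sqrt hC.le, ← Real.exp_nat_mul]
  convert! h z using 3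
  push_cast; ring

end IsBaseDensity

/-! ### Transformation models with a differentiable transformation -/

namespace IsBaseDensity

variable {f : ℝ → ℝ}

theorem cdf_sub (hf : IsBaseDensity f) {c d : ℝ} (hcd : c ≤ d) :
    ENNReal.ofReal ((∫ s in Set.Iic d, f s) - ∫ s in Set.Iic c, f s) =
      ∫⁻ z in Set.Ioc c d, ENNReal.ofReal (f z) := by
  rw [intervalIntegral.integral_Iic_sub_Iic hf.integrable.integrableOn hf.integrable.integrableOn,
    intervalIntegral.integral_of_le hcd,
    ofReal_integral_eq_lintegral_ofReal hf.integrable.integrableOn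
      (Eventually.of_forall fun z => (hf.pos z).le)]

theorem lintegral_eq_one (hf : IsBaseDensity f) : ∫⁻ z, ENNReal.ofReal (f z) = 1 := by
  rw [← ofReal_integral_eq_lintegral_ofReal hf.integrable
    (Eventually.of_forall fun z => (hf.pos z).le), hf.integral_eq_one, ENNReal.ofReal_one]

theorem ofReal_cdf (hf : IsBaseDensity f) (z : ℝ) :
    ENNReal.ofReal (∫ s in Set.Iic z, f s) = ∫⁻ s in Set.Iic z, ENNReal.ofReal (f s) :=
  ofReal_integral_eq_lintegral_ofReal hf.integrable.integrableOn
    (Eventually.of_forall fun z => (hf.pos z).le)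

theorem cdf_nonneg (hf : IsBaseDensity f) (z : ℝ) : 0 ≤ ∫ s in Set.Iic z, f s :=
  integral_nonneg fun s => (hf.pos s).le

theorem cdf_le_one (hf : IsBaseDensity f) (z : ℝ) : ∫ s in Set.Iic z, f s ≤ 1 := by
  rw [← hf.integral_eq_one]
  exact setIntegral_le_integral hf.integrable (Eventually.of_forall fun s => (hf.pos s).le)

theorem strictMono_cdf (hf : IsBaseDensity f) : StrictMono fun z => ∫ s in Set.Iic z, f s := by
  intro c d hcd
  have h : 0 < (∫ s in Set.Iic d, f s) - ∫ s in Set.Iic c, f s := by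
    rw [intervalIntegral.integral_Iic_sub_Iic hf.integrable.integrableOn
      hf.integrable.integrableOn]
    exact intervalIntegral.intervalIntegral_pos_of_pos (hf.integrable.intervalIntegrable) hf.pos hcd
  exact sub_pos.1 h

end IsBaseDensity

/-- `H w` is, for every `w`, a transformation of the open interval `Ξ` with derivative `D w > 0`. -/
structure IsTransform {𝒲 : Type*} [MeasurableSpace 𝒲] (Ξ : Set ℝ) (H D : 𝒲 → ℝ → ℝ) : Prop where
  isOpen : IsOpen Ξ
  ordConnected : Ξ.OrdConnected
  measurable : Measurable fun v : 𝒲 × ℝ => H v.1 v.2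
  measurable_deriv : Measurable fun v : 𝒲 × ℝ => D v.1 v.2
  hasDerivAt : ∀ w, ∀ y ∈ Ξ, HasDerivAt (H w) (D w y) y
  deriv_pos : ∀ w, ∀ y ∈ Ξ, 0 < D w y

/-- The conditional density of the outcome in the transformation model with base density `f`. -/
def transformDensity {𝒲 : Type*} (f : ℝ → ℝ) (H D : 𝒲 → ℝ → ℝ) (v : 𝒲 × ℝ) : ℝ :=
  f (H v.1 v.2) * D v.1 v.2

namespace IsTransform

variable {𝒲 : Type*} [MeasurableSpace 𝒲] {Ξ : Set ℝ} {f : ℝ → ℝ} {H D H' D' : 𝒲 → ℝ → ℝ}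

theorem strictMonoOn (h : IsTransform Ξ H D) (w : 𝒲) : StrictMonoOn (H w) Ξ := by
  refine strictMonoOn_of_deriv_pos h.ordConnected.convex
    (fun y hy => (h.hasDerivAt w y hy).continuousAt.continuousWithinAt) fun y hy => ?_
  rw [h.isOpen.interior_eq] at hy
  rw [(h.hasDerivAt w y hy).deriv]
  exact h.deriv_pos w y hy

theorem measurable_transformDensity (h : IsTransform Ξ H D) (hf : IsBaseDensity f) :
    Measurable (transformDensity f H D) :=
  (hf.continuous.measurable.comp h.measurable).mul h.measurable_deriv

theorem transformDensity_pos (h : IsTransform Ξ H D) (hf : IsBaseDensity f) (w : 𝒲) {y : ℝ}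
    (hy : y ∈ Ξ) : 0 < transformDensity f H D (w, y) :=
  mul_pos (hf.pos _) (h.deriv_pos w y hy)

theorem lintegral_comp (h : IsTransform Ξ H D) (w : 𝒲) {s : Set ℝ} (hs : MeasurableSet s)
    (hsΞ : s ⊆ Ξ) (u : ℝ → ENNReal) :
    ∫⁻ y in s, u (H w y) * ENNReal.ofReal (D w y) = ∫⁻ z in H w '' s, u z := by
  rw [lintegral_image_eq_lintegral_abs_deriv_mul hs
    (fun y hy => (h.hasDerivAt w y (hsΞ hy)).hasDerivWithinAt)
    ((h.strictMonoOn w).injOn.mono hsΞ)]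
  refine setLIntegral_congr_fun hs fun y hy => ?_
  rw [abs_of_pos (h.deriv_pos w y (hsΞ hy)), mul_comm]

theorem lintegral_comp_density (h : IsTransform Ξ H D) (hf : IsBaseDensity f) (w : 𝒲) {s : Set ℝ}
    (hs : MeasurableSet s) (hsΞ : s ⊆ Ξ) (u : ℝ → ENNReal) :
    ∫⁻ y in s, ENNReal.ofReal (transformDensity f H D (w, y)) * u (H w y) =
      ∫⁻ z in H w '' s, ENNReal.ofReal (f z) * u z := by
  rw [← h.lintegral_comp w hs hsΞ]
  refine setLIntegral_congr_fun hs fun y _ => ?_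
  dsimp only [transformDensity]
  rw [ENNReal.ofReal_mul (hf.pos _).le]
  ring

theorem lintegral_density (h : IsTransform Ξ H D) (hf : IsBaseDensity f) (w : 𝒲) {s : Set ℝ}
    (hs : MeasurableSet s) (hsΞ : s ⊆ Ξ) :
    ∫⁻ y in s, ENNReal.ofReal (transformDensity f H D (w, y)) =
      ∫⁻ z in H w '' s, ENNReal.ofReal (f z) := by
  simpa using h.lintegral_comp_density hf w hs hsΞ (fun _ => 1)

theorem lintegral_density_le_one (h : IsTransform Ξ H D) (hf : IsBaseDensity f) (w : 𝒲) :
    ∫⁻ y in Ξ, ENNReal.ofReal (transformDensity f H D (w, y)) ≤ 1 := by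
  rw [h.lintegral_density hf w h.isOpen.measurableSet subset_rfl, ← hf.lintegral_eq_one]
  exact setLIntegral_le_lintegral _ _

theorem image_Ioc (h : IsTransform Ξ H D) (w : 𝒲) {c d : ℝ} (hc : c ∈ Ξ) (hd : d ∈ Ξ)
    (hcd : c ≤ d) : H w '' Set.Ioc c d = Set.Ioc (H w c) (H w d) := by
  have hsub : Set.Icc c d ⊆ Ξ := h.ordConnected.out hc hd
  apply Set.Subset.antisymm
  · rintro _ ⟨y, hy, rfl⟩
    have hyΞ := hsub (Set.Ioc_subset_Icc_self hy)
    exact ⟨h.strictMonoOn w hc hyΞ hy.1, (h.strictMonoOn w).monotoneOn hyΞ hd hy.2⟩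
  · exact intermediate_value_Ioc hcd
      fun y hy => (h.hasDerivAt w y (hsub hy)).continuousAt.continuousWithinAt

theorem lintegral_density_Ioc (h : IsTransform Ξ H D) (hf : IsBaseDensity f) (w : 𝒲) {c d : ℝ}
    (hc : c ∈ Ξ) (hd : d ∈ Ξ) (hcd : c ≤ d) :
    ∫⁻ y in Set.Ioc c d, ENNReal.ofReal (transformDensity f H D (w, y)) =
      ENNReal.ofReal ((∫ s in Set.Iic (H w d), f s) - ∫ s in Set.Iic (H w c), f s) := by
  rw [h.lintegral_density hf w measurableSet_Ioc
    (Set.Ioc_subset_Icc_self.trans (h.ordConnected.out hc hd)), h.image_Ioc w hc hd hcd,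
    hf.cdf_sub ((h.strictMonoOn w).monotoneOn hc hd hcd)]

/-- If the conditional density has total mass one, its distribution function is the base
distribution function of the transformation. -/
theorem lintegral_density_Iic (h : IsTransform Ξ H D) (hf : IsBaseDensity f) (w : 𝒲)
    (hone : ∫⁻ y in Ξ, ENNReal.ofReal (transformDensity f H D (w, y)) = 1) {c : ℝ} (hc : c ∈ Ξ) :
    ∫⁻ y in Ξ ∩ Set.Iic c, ENNReal.ofReal (transformDensity f H D (w, y)) =
      ENNReal.ofReal (∫ s in Set.Iic (H w c), f s) := by
  have hΞ := h.isOpen.measurableSet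
  have h1 : ∫⁻ y in Ξ ∩ Set.Iic c, ENNReal.ofReal (transformDensity f H D (w, y)) ≤
      ∫⁻ z in Set.Iic (H w c), ENNReal.ofReal (f z) := by
    rw [h.lintegral_density hf w (hΞ.inter measurableSet_Iic) Set.inter_subset_left]
    refine lintegral_mono_set ?_
    rintro _ ⟨y, hy, rfl⟩
    exact (h.strictMonoOn w).monotoneOn hy.1 hc hy.2
  have h2 : ∫⁻ y in Ξ \ Set.Iic c, ENNReal.ofReal (transformDensity f H D (w, y)) ≤
      ∫⁻ z in (Set.Iic (H w c))ᶜ, ENNReal.ofReal (f z) := by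
    rw [h.lintegral_density hf w (hΞ.diff measurableSet_Iic) Set.sdiff_subset]
    refine lintegral_mono_set ?_
    rintro _ ⟨y, hy, rfl⟩
    have hlt : c < y := not_le.1 hy.2
    exact not_le.2 (h.strictMonoOn w hc hy.1 hlt)
  have h3 := lintegral_inter_add_sdiff
    (fun y => ENNReal.ofReal (transformDensity f H D (w, y))) Ξ (μ := volume)
      (measurableSet_Iic (a := c))
  have h4 := lintegral_add_compl (fun z => ENNReal.ofReal (f z)) (μ := volume)
    (measurableSet_Iic (a := H w c))
  rw [hone] at h3
  rw [hf.lintegral_eq_one] at h4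
  rw [hf.ofReal_cdf]
  -- `h1` and `h2` bound the two pieces of one unit mass by the two pieces of another, so neither
  -- inequality can be strict.
  refine le_antisymm h1 ?_
  have hfin : ∫⁻ z in (Set.Iic (H w c))ᶜ, ENNReal.ofReal (f z) ≠ ⊤ := by
    refine ne_top_of_le_ne_top ENNReal.one_ne_top ?_
    rw [← h4]
    exact le_add_self
  rw [← ENNReal.add_le_add_iff_right hfin, h4, ← h3]
  gcongr

/-- As `f` is positive everywhere, any non-null set of latent values missed by the transformation
would cost mass. -/
theorem volume_compl_image_eq_zero (h : IsTransform Ξ H D) (hf : IsBaseDensity f) (w : 𝒲)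
    (hone : ∫⁻ y in Ξ, ENNReal.ofReal (transformDensity f H D (w, y)) = 1) :
    volume (H w '' Ξ)ᶜ = 0 := by
  have hΞ := h.isOpen.measurableSet
  have him : MeasurableSet (H w '' Ξ) := by
    have hoc : (H w '' Ξ).OrdConnected := by
      have hpc := h.ordConnected.isPreconnected.image (H w)
        fun y hy => (h.hasDerivAt w y hy).continuousAt.continuousWithinAt
      exact hpc.ordConnected
    exact hoc.measurableSet
  have h4 := lintegral_add_compl (fun z => ENNReal.ofReal (f z)) (μ := volume) him
  rw [← h.lintegral_density hf w hΞ subset_rfl, hone, hf.lintegral_eq_one] at h4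
  have h5 : ∫⁻ z in (H w '' Ξ)ᶜ, ENNReal.ofReal (f z) = 0 :=
    (ENNReal.add_right_inj ENNReal.one_ne_top).1 (h4.trans (add_zero 1).symm)
  rw [lintegral_eq_zero_iff hf.continuous.measurable.ennreal_ofReal] at h5
  have h6 : ∀ᵐ z ∂(volume.restrict (H w '' Ξ)ᶜ), False := by
    filter_upwards [h5] with z hz
    exact absurd (ENNReal.ofReal_eq_zero.1 hz) (not_le.2 (hf.pos z))
  rw [ae_iff] at h6
  simpa using h6

/-- The joint law of covariates with law `ν` and an outcome that follows the model. -/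
def jointLaw (ν : Measure 𝒲) (Ξ : Set ℝ) (f : ℝ → ℝ) (H D : 𝒲 → ℝ → ℝ) : Measure (𝒲 × ℝ) :=
  (ν.prod (volume.restrict Ξ)).withDensity fun v => ENNReal.ofReal (transformDensity f H D v)

variable {ν : Measure 𝒲}

theorem lintegral_jointLaw [SFinite ν] (h : IsTransform Ξ H D) (hf : IsBaseDensity f)
    {u : 𝒲 × ℝ → ENNReal} (hu : Measurable u) :
    ∫⁻ v, u v ∂(jointLaw ν Ξ f H D) =
      ∫⁻ w, ∫⁻ y in Ξ, ENNReal.ofReal (transformDensity f H D (w, y)) * u (w, y) ∂volume ∂ν := by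
  have hm := (h.measurable_transformDensity hf).ennreal_ofReal
  rw [jointLaw, lintegral_withDensity_eq_lintegral_mul _ hm hu,
    lintegral_prod _ (hm.mul hu).aemeasurable]
  rfl

theorem jointLaw_prod [SFinite ν] (h : IsTransform Ξ H D) (hf : IsBaseDensity f)
    {B : Set 𝒲} (hB : MeasurableSet B) {s : Set ℝ} (hs : MeasurableSet s) :
    jointLaw ν Ξ f H D (B ×ˢ s) =
      ∫⁻ w in B, ∫⁻ y in s ∩ Ξ, ENNReal.ofReal (transformDensity f H D (w, y)) ∂volume ∂ν := by
  have hm := (h.measurable_transformDensity hf).ennreal_ofReal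
  rw [jointLaw, withDensity_apply _ (hB.prod hs), ← Measure.prod_restrict,
    Measure.restrict_restrict hs, lintegral_prod _ hm.aemeasurable]

theorem isFiniteMeasure_jointLaw [IsProbabilityMeasure ν] (h : IsTransform Ξ H D)
    (hf : IsBaseDensity f) : IsFiniteMeasure (jointLaw ν Ξ f H D) := by
  refine ⟨?_⟩
  rw [← Set.univ_prod_univ, h.jointLaw_prod hf .univ .univ, Set.univ_inter,
    Measure.restrict_univ]
  calc _ ≤ ∫⁻ _, 1 ∂ν := lintegral_mono fun w => h.lintegral_density_le_one hf w
    _ < ⊤ := by simp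

/-- The conditional distribution function is prescribed only at points of Ξ. This countable cover
lets two measures be compared through intervals whose endpoints lie in Ξ. -/
theorem iUnion_rat_Ioc (hΞ : IsOpen Ξ) (hΞ' : Ξ.OrdConnected) :
    (⋃ q : {q : ℚ × ℚ // (q.1 : ℝ) ∈ Ξ ∧ (q.2 : ℝ) ∈ Ξ},
      Set.Ioc (q.1.1 : ℝ) (q.1.2 : ℝ)) = Ξ := by
  ext y
  simp only [Set.mem_iUnion]
  constructor
  · rintro ⟨⟨q, h1, h2⟩, hq⟩
    exact hΞ'.out h1 h2 (Set.Ioc_subset_Icc_self hq)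
  · intro hy
    obtain ⟨l, u, ⟨hl, hu⟩, hsub⟩ := mem_nhds_iff_exists_Ioo_subset.1 (hΞ.mem_nhds hy)
    obtain ⟨q₁, h1, h1'⟩ := exists_rat_btwn hl
    obtain ⟨q₂, h2, h2'⟩ := exists_rat_btwn hu
    exact ⟨⟨(q₁, q₂), hsub ⟨h1, h1'.trans hu⟩, hsub ⟨hl.trans h2, h2'⟩⟩, h1', h2.le⟩

/-- The joint law of covariates `W` and an outcome `Y` whose conditional distribution function is
that of the model. -/
theorem map_prodMk_eq_jointLaw {Ω : Type*} [MeasurableSpace Ω] {μ : Measure Ω}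
    [IsProbabilityMeasure μ] (h : IsTransform Ξ H D) (hf : IsBaseDensity f) {W : Ω → 𝒲}
    {Y : Ω → ℝ} (hW : Measurable W) (hY : Measurable Y) (hYΞ : ∀ᵐ ω ∂μ, Y ω ∈ Ξ)
    (hcond : ∀ y ∈ Ξ, ∀ B, MeasurableSet B → μ.real (W ⁻¹' B ∩ {ω | Y ω ≤ y}) =
      ∫ ω in W ⁻¹' B, ∫ s in Set.Iic (H (W ω) y), f s ∂volume ∂μ) :
    μ.map (fun ω => (W ω, Y ω)) = jointLaw (μ.map W) Ξ f H D := by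
  have hν : IsProbabilityMeasure (μ.map W) := Measure.isProbabilityMeasure_map hW.aemeasurable
  have hWY : Measurable fun ω => (W ω, Y ω) := hW.prodMk hY
  have : IsProbabilityMeasure (μ.map fun ω => (W ω, Y ω)) :=
    Measure.isProbabilityMeasure_map hWY.aemeasurable
  have hfin := h.isFiniteMeasure_jointLaw hf (ν := μ.map W)
  have hmH : ∀ y, Measurable fun w => H w y := fun y =>
    h.measurable.comp (measurable_id.prodMk measurable_const)
  have hcdf : Measurable fun z => ∫ s in Set.Iic z, f s := hf.strictMono_cdf.monotone.measurable
  have hint : ∀ y, Integrable (fun ω => ∫ s in Set.Iic (H (W ω) y), f s) μ := fun y =>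
    Integrable.of_bound (hcdf.comp ((hmH y).comp hW)).aestronglyMeasurable 1
      (Eventually.of_forall fun ω => by
        rw [Real.norm_of_nonneg (hf.cdf_nonneg _)]
        exact hf.cdf_le_one _)
  have key : ∀ B, MeasurableSet B → ∀ c ∈ Ξ, ∀ d ∈ Ξ, c ≤ d →
      μ (W ⁻¹' B ∩ Y ⁻¹' Set.Ioc c d) = jointLaw (μ.map W) Ξ f H D (B ×ˢ Set.Ioc c d) := by
    intro B hB c hc d hd hcd
    have hsub : Set.Ioc c d ⊆ Ξ := Set.Ioc_subset_Icc_self.trans (h.ordConnected.out hc hd)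
    have hBm := hW hB
    rw [h.jointLaw_prod hf hB measurableSet_Ioc, Set.inter_eq_left.2 hsub]
    simp_rw [h.lintegral_density_Ioc hf _ hc hd hcd]
    have hmd : Measurable fun w => ENNReal.ofReal
        ((∫ s in Set.Iic (H w d), f s) - ∫ s in Set.Iic (H w c), f s) :=
      ((hcdf.comp (hmH d)).sub (hcdf.comp (hmH c))).ennreal_ofReal
    rw [setLIntegral_map hB hmd hW,
      ← ofReal_integral_eq_lintegral_ofReal
        (f := fun ω => (∫ s in Set.Iic (H (W ω) d), f s) - ∫ s in Set.Iic (H (W ω) c), f s)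
        ((hint d).sub (hint c)).integrableOn
        (Eventually.of_forall fun ω => sub_nonneg.2 (hf.strictMono_cdf.monotone
          ((h.strictMonoOn _).monotoneOn hc hd hcd))),
      integral_sub (hint d).integrableOn (hint c).integrableOn,
      ← hcond d hd B hB, ← hcond c hc B hB]
    have hset : W ⁻¹' B ∩ Y ⁻¹' Set.Ioc c d =
        (W ⁻¹' B ∩ {ω | Y ω ≤ d}) \ (W ⁻¹' B ∩ {ω | Y ω ≤ c}) := by
      ext ω
      simp only [Set.mem_inter_iff, Set.mem_preimage, Set.mem_Ioc, Set.mem_sdiff,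
        Set.mem_ofPred_eq]
      constructor
      · rintro ⟨h1, h2, h3⟩
        exact ⟨⟨h1, h3⟩, fun h4 => absurd h4.2 (not_le.2 h2)⟩
      · rintro ⟨⟨h1, h2⟩, h3⟩
        exact ⟨h1, not_le.1 fun h4 => h3 ⟨h1, h4⟩, h2⟩
    rw [hset, ← measureReal_sdiff, ofReal_measureReal]
    · exact fun ω hω => ⟨hω.1, le_trans hω.2 hcd⟩
    · exact (hW hB).inter (measurableSet_le hY measurable_const)
  refine Measure.ext_prod fun {B s} hB hs => ?_
  rw [Measure.map_apply hWY (hB.prod hs), Set.mk_preimage_prod]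
  let m₁ : Measure ℝ := (μ.restrict (W ⁻¹' B)).map Y
  let m₂ : Measure ℝ := ((jointLaw (μ.map W) Ξ f H D).restrict (B ×ˢ Set.univ)).map Prod.snd
  have hm₁ : ∀ t, MeasurableSet t → m₁ t = μ (W ⁻¹' B ∩ Y ⁻¹' t) := fun t ht => by
    rw [Measure.map_apply hY ht, Measure.restrict_apply (hY ht), Set.inter_comm]
  have hm₂ : ∀ t, MeasurableSet t → m₂ t = jointLaw (μ.map W) Ξ f H D (B ×ˢ t) := fun t ht => by
    rw [Measure.map_apply measurable_snd ht, Measure.restrict_apply (measurable_snd ht)]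
    congr 1
    ext ⟨w, y⟩
    simp [and_comm]
  have hΞm := h.isOpen.measurableSet
  have hc₁ : m₁ Ξᶜ = 0 := by
    rw [hm₁ _ hΞm.compl]
    exact measure_mono_null Set.inter_subset_right hYΞ
  have hc₂ : m₂ Ξᶜ = 0 := by
    rw [hm₂ _ hΞm.compl, h.jointLaw_prod hf hB hΞm.compl]
    simp
  have hr : m₁.restrict Ξ = m₂.restrict Ξ := by
    have hcov := Measure.restrict_iUnion_congr (μ := m₁) (ν := m₂)
      (s := fun q : {q : ℚ × ℚ // (q.1 : ℝ) ∈ Ξ ∧ (q.2 : ℝ) ∈ Ξ} =>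
        Set.Ioc (q.1.1 : ℝ) (q.1.2 : ℝ))
    rw [iUnion_rat_Ioc h.isOpen h.ordConnected] at hcov
    refine hcov.2 ?_
    rintro ⟨⟨c, d⟩, hc, hd⟩
    dsimp only at hc hd ⊢
    refine Measure.ext_of_Ioc _ _ fun a b _ => ?_
    rw [Measure.restrict_apply measurableSet_Ioc, Measure.restrict_apply measurableSet_Ioc,
      Set.Ioc_inter_Ioc]
    rcases le_or_gt (max a (c : ℝ)) (min b d) with hle | hgt
    · have h1 : max a (c : ℝ) ∈ Ξ :=
        h.ordConnected.out hc hd ⟨le_max_right _ _, hle.trans (min_le_right _ _)⟩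
      have h2 : min b (d : ℝ) ∈ Ξ :=
        h.ordConnected.out hc hd ⟨(le_max_right _ _).trans hle, min_le_right _ _⟩
      rw [hm₁ _ measurableSet_Ioc, hm₂ _ measurableSet_Ioc, key B hB _ h1 _ h2 hle]
    · rw [Set.Ioc_eq_empty (not_lt.2 hgt.le)]
      simp
  rw [← hm₁ s hs, ← hm₂ s hs, ← Measure.restrict_eq_self_of_ae_mem (μ := m₁) (s := Ξ) hc₁,
    ← Measure.restrict_eq_self_of_ae_mem (μ := m₂) (s := Ξ) hc₂, hr]

end IsTransform

/-! ### Hellinger affinity of two transformation models -/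

namespace IsTransform

variable {𝒲 : Type*} [MeasurableSpace 𝒲] {Ξ : Set ℝ} {f : ℝ → ℝ} {H D H' D' : 𝒲 → ℝ → ℝ}
  {ν : Measure 𝒲}

theorem ae_jointLaw_mem [SFinite ν] (h : IsTransform Ξ H D) :
    ∀ᵐ v ∂(jointLaw ν Ξ f H D), v.2 ∈ Ξ := by
  refine (withDensity_absolutelyContinuous _ _).ae_le ?_
  have h1 : ∀ᵐ y ∂(volume.restrict Ξ), y ∈ Ξ := ae_restrict_mem h.isOpen.measurableSet
  exact (Measure.quasiMeasurePreserving_snd (μ := ν) (ν := volume.restrict Ξ)).ae h1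

/-- If the joint law has mass one, almost every conditional density has mass one. -/
theorem ae_lintegral_density_eq_one [IsProbabilityMeasure ν] (h : IsTransform Ξ H D)
    (hf : IsBaseDensity f) (hone : jointLaw ν Ξ f H D Set.univ = 1) :
    ∀ᵐ w ∂ν, ∫⁻ y in Ξ, ENNReal.ofReal (transformDensity f H D (w, y)) = 1 := by
  have hm : Measurable fun w => ∫⁻ y in Ξ, ENNReal.ofReal (transformDensity f H D (w, y)) :=
    (h.measurable_transformDensity hf).ennreal_ofReal.lintegral_prod_right'
  rw [← Set.univ_prod_univ, h.jointLaw_prod hf .univ .univ, Set.univ_inter,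
    Measure.restrict_univ] at hone
  refine ae_eq_of_ae_le_of_lintegral_le
    (Eventually.of_forall fun w => h.lintegral_density_le_one hf w) ?_ aemeasurable_const ?_
  · rw [hone]
    exact ENNReal.one_ne_top
  · rw [hone]
    simp

/-- The integral of the inverse square root of the base density at the transformed outcome. -/
theorem lintegral_inv_sqrt_le [IsProbabilityMeasure ν] (h : IsTransform Ξ H D)
    (hf : IsBaseDensity f) :
    ∫⁻ v, ENNReal.ofReal (1 / √(f (H v.1 v.2))) ∂(jointLaw ν Ξ f H D) ≤
      ∫⁻ z, ENNReal.ofReal (√(f z)) := by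
  have hc := hf.continuous
  have hu : Measurable fun z => ENNReal.ofReal (1 / √(f z)) := by
    have := hc.measurable
    fun_prop
  rw [h.lintegral_jointLaw hf (u := fun v => ENNReal.ofReal (1 / √(f (H v.1 v.2))))
    (hu.comp h.measurable)]
  calc _ ≤ ∫⁻ _, ∫⁻ z, ENNReal.ofReal (√(f z)) ∂volume ∂ν := by
        refine lintegral_mono fun w => ?_
        rw [h.lintegral_comp_density hf w h.isOpen.measurableSet subset_rfl
          fun z => ENNReal.ofReal (1 / √(f z))]
        refine (setLIntegral_le_lintegral _ _).trans (lintegral_mono fun z => ?_)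
        rw [← ENNReal.ofReal_mul (hf.pos z).le, mul_one_div, Real.div_sqrt]
    _ = _ := by simp

/-- The outcome `H (Y | W)` on the latent scale has density `f` and is independent of `W`. -/
theorem map_jointLaw [IsProbabilityMeasure ν] (h : IsTransform Ξ H D) (hf : IsBaseDensity f)
    (hone : jointLaw ν Ξ f H D Set.univ = 1) :
    (jointLaw ν Ξ f H D).map (fun v => (v.1, H v.1 v.2)) =
      ν.prod (volume.withDensity fun z => ENNReal.ofReal (f z)) := by
  have hm : Measurable fun v : 𝒲 × ℝ => (v.1, H v.1 v.2) := measurable_fst.prodMk h.measurable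
  have hfin := h.isFiniteMeasure_jointLaw hf (ν := ν)
  have : IsFiniteMeasure ((jointLaw ν Ξ f H D).map fun v => (v.1, H v.1 v.2)) :=
    inferInstance
  refine Measure.ext_prod fun {B s} hB hs => ?_
  have hp : IsProbabilityMeasure (volume.withDensity fun z => ENNReal.ofReal (f z)) :=
    ⟨by rw [withDensity_apply _ .univ, Measure.restrict_univ, hf.lintegral_eq_one]⟩
  rw [Measure.prod_prod, Measure.map_apply hm (hB.prod hs),
    ← lintegral_indicator_one (hm (hB.prod hs)),
    h.lintegral_jointLaw hf (measurable_one.indicator (hm (hB.prod hs)))]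
  have hval : ∀ᵐ w ∂ν, ∫⁻ y in Ξ, ENNReal.ofReal (transformDensity f H D (w, y)) *
      ((fun v : 𝒲 × ℝ => (v.1, H v.1 v.2)) ⁻¹' B ×ˢ s).indicator 1 (w, y) =
      B.indicator (fun _ => volume.withDensity (fun z => ENNReal.ofReal (f z)) s) w := by
    filter_upwards [h.ae_lintegral_density_eq_one hf hone] with w hw
    have h0 := h.volume_compl_image_eq_zero hf w hw
    by_cases hwB : w ∈ B
    · have hind : ∀ y, ((fun v : 𝒲 × ℝ => (v.1, H v.1 v.2)) ⁻¹' B ×ˢ s).indicator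
          (1 : 𝒲 × ℝ → ENNReal) (w, y) = s.indicator 1 (H w y) := by
        intro y
        by_cases hy : H w y ∈ s
        · rw [Set.indicator_of_mem hy, Set.indicator_of_mem]
          · rfl
          · exact ⟨hwB, hy⟩
        · rw [Set.indicator_of_notMem hy, Set.indicator_of_notMem]
          exact fun hcon => hy hcon.2
      simp_rw [hind]
      rw [Set.indicator_of_mem hwB,
        h.lintegral_comp_density hf w h.isOpen.measurableSet subset_rfl,
        Measure.restrict_eq_self_of_ae_mem (s := H w '' Ξ) h0, withDensity_apply _ hs,
        ← lintegral_indicator hs]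
      refine lintegral_congr fun z => ?_
      by_cases hz : z ∈ s <;> simp [hz]
    · rw [Set.indicator_of_notMem hwB, lintegral_eq_zero_iff']
      · refine Eventually.of_forall fun y => ?_
        dsimp only
        rw [Set.indicator_of_notMem]
        · simp
        · exact fun hcon => hwB hcon.1
      · exact (((h.measurable_transformDensity hf).ennreal_ofReal.mul
          (measurable_one.indicator (hm (hB.prod hs)))).comp measurable_prodMk_left).aemeasurable
  rw [lintegral_congr_ae hval, lintegral_indicator_const hB, mul_comm]

/-- The square root of the likelihood ratio of two models. -/
def sqrtRatio (f : ℝ → ℝ) (H' D' H D : 𝒲 → ℝ → ℝ) (v : 𝒲 × ℝ) : ENNReal :=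
  ENNReal.ofReal (√(transformDensity f H' D' v / transformDensity f H D v))

theorem measurable_sqrtRatio (h' : IsTransform Ξ H' D') (h : IsTransform Ξ H D)
    (hf : IsBaseDensity f) : Measurable (sqrtRatio f H' D' H D) :=
  ((h'.measurable_transformDensity hf).div
    (h.measurable_transformDensity hf)).sqrt.ennreal_ofReal

/-- The true density cancels and the mass of the competing one remains. It may be less than one,
because the competing transformation need not be onto the real line. -/
theorem lintegral_ratio_le_one [IsProbabilityMeasure ν] (h' : IsTransform Ξ H' D')
    (h : IsTransform Ξ H D) (hf : IsBaseDensity f) :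
    ∫⁻ v, ENNReal.ofReal (transformDensity f H' D' v / transformDensity f H D v)
      ∂(jointLaw ν Ξ f H D) ≤ 1 := by
  rw [h.lintegral_jointLaw hf
    (u := fun v => ENNReal.ofReal (transformDensity f H' D' v / transformDensity f H D v))
    ((h'.measurable_transformDensity hf).div (h.measurable_transformDensity hf)).ennreal_ofReal]
  calc _ ≤ ∫⁻ _, 1 ∂ν := by
        refine lintegral_mono fun w => ?_
        refine le_trans (le_of_eq ?_) (h'.lintegral_density_le_one hf w)
        refine setLIntegral_congr_fun h.isOpen.measurableSet fun y hy => ?_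
        rw [← ENNReal.ofReal_mul (h.transformDensity_pos hf w hy).le,
          mul_div_cancel₀ _ (h.transformDensity_pos hf w hy).ne']
    _ = 1 := by simp

/-- Two models with almost everywhere the same joint density have the same transformation. -/
theorem ae_eq_of_density_eq [IsProbabilityMeasure ν] (h' : IsTransform Ξ H' D')
    (h : IsTransform Ξ H D) (hf : IsBaseDensity f) (hone : jointLaw ν Ξ f H D Set.univ = 1)
    (heq : ∀ᵐ v ∂(jointLaw ν Ξ f H D), transformDensity f H' D' v = transformDensity f H D v) :
    ∀ᵐ w ∂ν, ∀ y ∈ Ξ, H' w y = H w y := by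
  have hΞ := h.isOpen.measurableSet
  rw [jointLaw, ae_withDensity_iff (h.measurable_transformDensity hf).ennreal_ofReal] at heq
  filter_upwards [Measure.ae_ae_of_ae_prod heq, h.ae_lintegral_density_eq_one hf hone]
    with w hw hw1 y hy
  have hae : ∀ᵐ y ∂(volume.restrict Ξ),
      transformDensity f H' D' (w, y) = transformDensity f H D (w, y) := by
    filter_upwards [hw, ae_restrict_mem hΞ] with y h1 hy
    exact h1 (ENNReal.ofReal_pos.2 (h.transformDensity_pos hf w hy)).ne'
  have hint : ∀ s ⊆ Ξ, ∫⁻ y in s, ENNReal.ofReal (transformDensity f H' D' (w, y)) =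
      ∫⁻ y in s, ENNReal.ofReal (transformDensity f H D (w, y)) := fun s hs =>
    lintegral_congr_ae ((ae_restrict_of_ae_restrict_of_subset hs hae).mono fun y hy => by
      dsimp only
      rw [hy])
  -- The competing density inherits mass one from the true one, so both distribution functions are
  -- the base one composed with the transformation; the base one is injective.
  have h1 := h.lintegral_density_Iic hf w hw1 hy
  have h2 := h'.lintegral_density_Iic hf w ((hint Ξ subset_rfl).trans hw1) hy
  rw [hint _ Set.inter_subset_left, h1,
    ENNReal.ofReal_eq_ofReal_iff (hf.cdf_nonneg _) (hf.cdf_nonneg _)] at h2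
  exact (hf.strictMono_cdf.injective h2).symm

/-- Strict inequality for the Hellinger affinity of two different models. -/
theorem lintegral_sqrtRatio_lt_one [IsProbabilityMeasure ν] (h' : IsTransform Ξ H' D')
    (h : IsTransform Ξ H D) (hf : IsBaseDensity f) (hone : jointLaw ν Ξ f H D Set.univ = 1)
    (hne : ¬ ∀ᵐ w ∂ν, ∀ y ∈ Ξ, H' w y = H w y) :
    ∫⁻ v, sqrtRatio f H' D' H D v ∂(jointLaw ν Ξ f H D) < 1 := by
  by_contra hcon
  rw [not_lt] at hcon
  apply hne
  refine ae_eq_of_density_eq h' h hf hone ?_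
  set R : 𝒲 × ℝ → ℝ := fun v => transformDensity f H' D' v / transformDensity f H D v with hR
  have hRm : Measurable R :=
    (h'.measurable_transformDensity hf).div (h.measurable_transformDensity hf)
  have hRpos : ∀ v : 𝒲 × ℝ, v.2 ∈ Ξ → 0 < R v := fun v hv =>
    div_pos (h'.transformDensity_pos hf v.1 hv) (h.transformDensity_pos hf v.1 hv)
  have hmem := h.ae_jointLaw_mem (ν := ν) (f := f)
  -- √R ≤ (1 + R)/2, and the right side has integral at most one. An affinity of at least one thus
  -- forces equality almost everywhere, that is, √R = 1.
  have hle : ∀ᵐ v ∂(jointLaw ν Ξ f H D),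
      sqrtRatio f H' D' H D v ≤ ENNReal.ofReal ((1 + R v) / 2) := by
    filter_upwards [hmem] with v hv
    refine ENNReal.ofReal_le_ofReal ?_
    have h1 := Real.sq_sqrt (hRpos v hv).le
    have h2 := sq_nonneg (√(R v) - 1)
    change √(R v) ≤ _
    nlinarith
  have hle1 : ∫⁻ v, ENNReal.ofReal ((1 + R v) / 2) ∂(jointLaw ν Ξ f H D) ≤ 1 := by
    have h1 : ∫⁻ v, ENNReal.ofReal ((1 + R v) / 2) ∂(jointLaw ν Ξ f H D) =
        ∫⁻ v, (1 / 2 + ENNReal.ofReal (R v) * (1 / 2)) ∂(jointLaw ν Ξ f H D) := by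
      refine lintegral_congr_ae ?_
      filter_upwards [hmem] with v hv
      have h2 := (hRpos v hv).le
      rw [add_div, ENNReal.ofReal_add (by norm_num) (by positivity),
        div_eq_mul_one_div (R v), ENNReal.ofReal_mul h2]
      have h3 : ENNReal.ofReal (1 / 2) = 1 / 2 := by
        rw [ENNReal.ofReal_div_of_pos (by norm_num)]
        simp
      rw [h3]
    rw [h1, lintegral_add_left measurable_const, lintegral_const, hone, mul_one,
      lintegral_mul_const _ hRm.ennreal_ofReal]
    calc (1 / 2 : ENNReal) + _ * (1 / 2) ≤ 1 / 2 + 1 * (1 / 2) := by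
          gcongr
          exact lintegral_ratio_le_one h' h hf
      _ = 1 := by rw [one_mul, ENNReal.add_halves]
  have hae := ae_eq_of_ae_le_of_lintegral_le hle
    (ne_top_of_le_ne_top ENNReal.one_ne_top ((lintegral_mono_ae hle).trans hle1))
    ((hRm.const_add 1).div_const 2).ennreal_ofReal.aemeasurable (hle1.trans hcon)
  filter_upwards [hae, hmem] with v hv hvΞ
  have h0 := hRpos v hvΞ
  rw [sqrtRatio, ENNReal.ofReal_eq_ofReal_iff (Real.sqrt_nonneg _) (by positivity)] at hv
  change √(R v) = _ at hv
  have h1 := Real.sq_sqrt h0.le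
  have h2 : (√(R v) - 1) ^ 2 = 0 := by nlinarith
  have h3 : √(R v) = 1 := by
    have := pow_eq_zero_iff (two_ne_zero) |>.1 h2
    linarith
  have h4 : R v = 1 := by rw [← h1, h3]; norm_num
  exact (div_eq_one_iff_eq (h.transformDensity_pos hf v.1 hvΞ).ne').1 h4

/-- The outcome has no atoms given the covariates. -/
theorem jointLaw_graph_eq_zero [IsProbabilityMeasure ν] {g : ℝ → ℝ} (hg : Measurable g) (hginj : Set.InjOn g Ξ)
    {k : 𝒲 → ℝ} (hk : Measurable k) :
    jointLaw ν Ξ f H D {v | g v.2 = k v.1} = 0 := by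
  refine withDensity_absolutelyContinuous _ _ ?_
  have hm : MeasurableSet {v : 𝒲 × ℝ | g v.2 = k v.1} :=
    measurableSet_eq_fun (hg.comp measurable_snd) (hk.comp measurable_fst)
  rw [Measure.measure_prod_null hm]
  refine Eventually.of_forall fun w => ?_
  dsimp only
  rw [Measure.restrict_apply (measurable_prodMk_left hm)]
  refine Set.Subsingleton.measure_zero ?_ _
  rintro y ⟨hy, hyΞ⟩ y' ⟨hy', hyΞ'⟩
  exact hginj hyΞ hyΞ' (Eq.trans hy (Eq.symm hy'))

end IsTransform

/-- If `V` and `V + Z` have the same law, where `Z` is independent of `V`, then `Z` does not have a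
density. -/
theorem false_of_map_add_eq {Ω : Type*} [MeasurableSpace Ω] {μ : Measure Ω}
    [IsProbabilityMeasure μ] {V Z : Ω → ℝ} (hV : Measurable V) (hZ : Measurable Z)
    (hind : ProbabilityTheory.IndepFun V Z μ) (hlaw : μ.map (fun ω => V ω + Z ω) = μ.map V)
    (hac : μ.map Z ≪ volume) : False := by
  have hpV : IsProbabilityMeasure (μ.map V) := Measure.isProbabilityMeasure_map hV.aemeasurable
  have hpZ : IsProbabilityMeasure (μ.map Z) := Measure.isProbabilityMeasure_map hZ.aemeasurable
  have h1 := hind.map_add_eq_map_conv_map₀ hV.aemeasurable hZ.aemeasurable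
  change μ.map (fun ω => V ω + Z ω) = _ at h1
  -- The characteristic functions satisfy φ_V φ_Z = φ_V, and φ_V is nonzero near 0, so φ_Z = 1
  -- there.
  have hev : ∀ᶠ t in 𝓝 (0 : ℝ), charFun (μ.map V) t ≠ 0 := by
    refine (continuous_charFun (μ := μ.map V)).continuousAt.eventually_ne ?_
    simp
  have hev1 : ∀ᶠ t in 𝓝 (0 : ℝ), charFun (μ.map Z) t = 1 := by
    filter_upwards [hev] with t ht
    have h2 := congrArg (fun m => charFun m t) (hlaw.symm.trans h1)
    simp only [charFun_conv] at h2
    exact mul_left_cancel₀ ht (by rw [mul_one]; exact h2.symm)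
  obtain ⟨δ, hδ, hball⟩ := Metric.eventually_nhds_iff.1 hev1
  set t := δ / 2 with ht
  have ht0 : 0 < t := by positivity
  have hct : charFun (μ.map Z) t = 1 := hball (by
    rw [Real.dist_eq, sub_zero, abs_of_pos ht0]; linarith)
  -- The real part of φ_Z(t) = 1 gives cos(tZ) = 1 almost surely. This confines Z to a lattice,
  -- which is a null set.
  have hcos : ∫ z, (1 - Real.cos (t * z)) ∂(μ.map Z) = 0 := by
    rw [charFun_apply_real] at hct
    have hint : Integrable (fun z : ℝ => Complex.exp (t * z * Complex.I)) (μ.map Z) := by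
      refine Integrable.of_bound (by fun_prop) 1 (Eventually.of_forall fun z => ?_)
      rw [← Complex.ofReal_mul, Complex.norm_exp_ofReal_mul_I]
    have hre := congrArg Complex.re hct
    rw [← RCLike.re_eq_complex_re, ← integral_re hint] at hre
    have hre' : ∀ z : ℝ, RCLike.re (Complex.exp (t * z * Complex.I)) = Real.cos (t * z) := by
      intro z
      rw [RCLike.re_eq_complex_re, ← Complex.ofReal_mul, Complex.exp_ofReal_mul_I_re]
    simp only [hre'] at hre
    rw [integral_sub (integrable_const _), hre]
    · simp
    · refine Integrable.of_bound (by fun_prop) 1 (Eventually.of_forall fun z => ?_)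
      exact Real.abs_cos_le_one _
  have hnn : ∀ z, 0 ≤ 1 - Real.cos (t * z) := fun z => by linarith [Real.cos_le_one (t * z)]
  rw [integral_eq_zero_iff_of_nonneg hnn] at hcos
  · have hsub : ∀ᵐ z ∂(μ.map Z), z ∈ {z : ℝ | ∃ n : ℤ, (n : ℝ) * (2 * Real.pi) = t * z} := by
      filter_upwards [hcos] with z hz
      exact (Real.cos_eq_one_iff _).1 (by simpa [sub_eq_zero] using Eq.symm (sub_eq_zero.1 hz))
    have hcount : {z : ℝ | ∃ n : ℤ, (n : ℝ) * (2 * Real.pi) = t * z}.Countable := by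
      refine (Set.countable_range fun n : ℤ => (n : ℝ) * (2 * Real.pi) / t).mono ?_
      rintro z ⟨n, hn⟩
      exact ⟨n, by dsimp only; rw [hn, mul_div_cancel_left₀ _ ht0.ne']⟩
    have h0 : μ.map Z {z : ℝ | ∃ n : ℤ, (n : ℝ) * (2 * Real.pi) = t * z} = 0 :=
      hac (hcount.measure_zero _)
    have h1' : ∀ᵐ z ∂(μ.map Z), False := by
      filter_upwards [hsub, measure_eq_zero_iff_ae_notMem.1 h0] with z h1 h2
      exact h2 h1
    simp at h1'
    exact NeZero.ne (μ.map Z) h1'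
  · refine Integrable.of_bound (by fun_prop) 2 (Eventually.of_forall fun z => ?_)
    rw [Real.norm_of_nonneg (hnn z)]
    linarith [Real.neg_one_le_cos (t * z)]

/-! ### Domination of a family of functions near a parameter -/

/-- If `ρ θ` has integral less than one, then so has a function that dominates `ρ θ'` for all `θ'`
close to `θ`. -/
theorem exists_isOpen_lintegral_lt_one {P V : Type*} [TopologicalSpace P]
    [SecondCountableTopology P] [MeasurableSpace V] {J : Measure V} {Θ : Set P}
    {ρ : P → V → ENNReal} (hm : ∀ θ ∈ Θ, Measurable (ρ θ))
    (hc : ∀ᵐ v ∂J, ContinuousOn (fun θ => ρ θ v) Θ) {g : V → ENNReal} (hg : ∫⁻ v, g v ∂J ≠ ⊤)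
    (hle : ∀ᵐ v ∂J, ∀ θ ∈ Θ, ρ θ v ≤ g v) {θ : P} (hθ : θ ∈ Θ) (hlt : ∫⁻ v, ρ θ v ∂J < 1) :
    ∃ U, IsOpen U ∧ θ ∈ U ∧ ∃ σ : V → ENNReal, Measurable σ ∧ ∫⁻ v, σ v ∂J < 1 ∧
      ∀ᵐ v ∂J, ∀ θ' ∈ Θ ∩ U, ρ θ' v ≤ σ v := by
  have : Nonempty Θ := ⟨⟨θ, hθ⟩⟩
  obtain ⟨U, hU, hbasis⟩ := (nhds_basis_opens θ).exists_antitone_subbasis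
  set D := TopologicalSpace.denseSeq Θ with hD
  -- The supremum runs over a countable dense subset of Θ to stay measurable; continuity in the
  -- parameter extends the bound to all of Θ ∩ U n.
  let σ : ℕ → V → ENNReal := fun n v => ⨆ k, ⨆ _ : (D k : P) ∈ U n, ρ (D k) v
  have hσm : ∀ n, Measurable (σ n) := fun n =>
    Measurable.iSup fun k => Measurable.iSup_Prop _ (hm _ (D k).2)
  have hσ : ∀ᵐ v ∂J, ∀ n, ∀ θ' ∈ Θ ∩ U n, ρ θ' v ≤ σ n v := by
    filter_upwards [hc] with v hv n θ' hθ'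
    by_contra! hcon
    have hcont : Continuous fun ϑ : Θ => ρ ϑ v := continuousOn_iff_continuous_domRestrict.1 hv
    have hopen : IsOpen {ϑ : Θ | σ n v < ρ ϑ v ∧ (ϑ : P) ∈ U n} :=
      (isOpen_lt continuous_const hcont).inter ((hU n).2.preimage continuous_subtype_val)
    obtain ⟨k, hk⟩ :=
      (TopologicalSpace.denseRange_denseSeq Θ).exists_mem_open hopen ⟨⟨θ', hθ'.1⟩, hcon, hθ'.2⟩
    have hle' : ρ (D k) v ≤ σ n v :=
      le_iSup₂ (f := fun k (_ : (D k : P) ∈ U n) => ρ (D k) v) k hk.2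
    exact absurd hle' (not_le.2 hk.1)
  have hlim : Tendsto (fun n => ∫⁻ v, σ n v ∂J) atTop (𝓝 (∫⁻ v, ρ θ v ∂J)) := by
    refine tendsto_lintegral_of_dominated_convergence g hσm (fun n => ?_) hg ?_
    · filter_upwards [hle] with v hv
      exact iSup₂_le fun k _ => hv _ (D k).2
    · filter_upwards [hc, hσ] with v hv hσv
      refine tendsto_order.2 ⟨fun c hc => Eventually.of_forall fun n =>
        hc.trans_le (hσv n θ ⟨hθ, (hU n).1⟩), fun c hc => ?_⟩
      obtain ⟨c', h1, h2⟩ := exists_between hc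
      have hnhds : {ϑ | ρ ϑ v < c'} ∈ 𝓝[Θ] θ := (hv θ hθ).eventually_lt_const h1
      obtain ⟨W, hW, hsub⟩ := mem_nhdsWithin_iff_exists_mem_nhds_inter.1 hnhds
      obtain ⟨n, hn⟩ := hbasis.mem_iff.1 hW
      filter_upwards [eventually_ge_atTop n] with m hm
      refine lt_of_le_of_lt (iSup₂_le fun k hk => ?_) h2
      exact le_of_lt (hsub ⟨hn (hbasis.antitone hm hk), (D k).2⟩)
  obtain ⟨n, hn⟩ := (hlim.eventually_lt_const hlt).exists
  exact ⟨U n, (hU n).2, (hU n).1, σ n, hσm n, hn, hσ.mono fun v hv => hv n⟩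

/-! ### Calculus of the model -/

instance {m n : Type*} [Countable m] [Countable n] :
    SecondCountableTopology (Matrix m n ℝ) :=
  inferInstanceAs (SecondCountableTopology (m → n → ℝ))

namespace ATModel

variable {M O q p : ℕ} {𝒳 : Type*} [MeasurableSpace 𝒳]

/-- The derivative of `h₁` on the sample space. -/
def slope (A : ATModel M O q 𝒳) (θ : ATParam M O q p) (x : 𝒳) (y : ℝ) : ℝ :=
  ∑ m, deriv (fun s => A.a s m) y * A.coeff θ x m

variable (A : ATModel M O q 𝒳)

theorem hasDerivAt_h₁ (θ : ATParam M O q p) (x : 𝒳) {y : ℝ} (hy : y ∈ A.Ξ) :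
    HasDerivAt (A.h₁ θ x) (A.slope θ x y) y := by
  have hd : DifferentiableAt ℝ A.a y :=
    (A.contDiffOn_a.differentiableOn (by norm_num)).differentiableAt (A.isOpen_Ξ.mem_nhds hy)
  exact HasDerivAt.fun_sum fun m _ =>
    (differentiableAt_pi.1 hd m).hasDerivAt.mul_const (A.coeff θ x m)

theorem hasDerivAt_h (θ : ATParam M O q p) (x : 𝒳) (l : Fin p → ℝ) {y : ℝ} (hy : y ∈ A.Ξ) :
    HasDerivAt (A.h θ x l) (A.slope θ x y) y :=
  (A.hasDerivAt_h₁ θ x hy).add_const _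

theorem slope_pos {θ : ATParam M O q p} (hθ : A.IsIncreasing θ) (x : 𝒳) {y : ℝ} (hy : y ∈ A.Ξ) :
    0 < A.slope θ x y := by
  rw [← (A.hasDerivAt_h₁ θ x hy).deriv]
  exact hθ x y hy

theorem continuous_coeff (x : 𝒳) (m : Fin (M + 1)) :
    Continuous fun θ : ATParam M O q p => A.coeff θ x m :=
  (continuous_apply m).comp (continuous_fst.matrix_mulVec continuous_const)

theorem continuous_slope (x : 𝒳) (y : ℝ) :
    Continuous fun θ : ATParam M O q p => A.slope θ x y :=
  continuous_finsetSum _ fun m _ => continuous_const.mul (A.continuous_coeff x m)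

theorem continuous_h₁ (x : 𝒳) (y : ℝ) : Continuous fun θ : ATParam M O q p => A.h₁ θ x y :=
  continuous_finsetSum _ fun m _ => continuous_const.mul (A.continuous_coeff x m)

theorem continuous_h (x : 𝒳) (l : Fin p → ℝ) (y : ℝ) :
    Continuous fun θ : ATParam M O q p => A.h θ x l y := by
  refine (A.continuous_h₁ x y).add ((continuous_finsetSum _ fun i _ => ?_).add ?_)
  · exact ((continuous_apply i).comp (continuous_fst.comp continuous_snd)).mul
      (A.continuous_h₁ x (l i))
  · exact (A.continuous_r x).comp (continuous_snd.comp continuous_snd)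

theorem measurable_coeff (θ : ATParam M O q p) (m : Fin (M + 1)) :
    Measurable fun x => A.coeff θ x m := by
  change Measurable fun x => ∑ o, θ.1 m o * A.b x o
  exact Finset.measurable_fun_sum _ fun o _ =>
    ((measurable_pi_apply o).comp A.measurable_b).const_mul _

theorem measurable_slope (θ : ATParam M O q p) :
    Measurable fun v : 𝒳 × ℝ => A.slope θ v.1 v.2 :=
  Finset.measurable_fun_sum _ fun m _ =>
    ((measurable_deriv fun s => A.a s m).comp measurable_snd).mul
      ((A.measurable_coeff θ m).comp measurable_fst)

variable {A}

theorem measurable_h₁ (ha : Measurable A.a) (θ : ATParam M O q p) :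
    Measurable fun v : 𝒳 × ℝ => A.h₁ θ v.1 v.2 :=
  Finset.measurable_fun_sum _ fun m _ =>
    (((measurable_pi_apply m).comp ha).comp measurable_snd).mul
      ((A.measurable_coeff θ m).comp measurable_fst)

theorem measurable_h (ha : Measurable A.a) (θ : ATParam M O q p) :
    Measurable fun v : (𝒳 × (Fin p → ℝ)) × ℝ => A.h θ v.1.1 v.1.2 v.2 := by
  have h1 := A.measurable_h₁ ha θ
  refine (h1.comp ((measurable_fst.comp measurable_fst).prodMk measurable_snd)).add
    ((Finset.measurable_fun_sum _ fun i _ => Measurable.const_mul ?_ _).add ?_)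
  · exact h1.comp ((measurable_fst.comp measurable_fst).prodMk
      ((measurable_pi_apply i).comp (measurable_snd.comp measurable_fst)))
  · exact (A.measurable_r θ.2.2).comp (measurable_fst.comp measurable_fst)

theorem isTransform (ha : Measurable A.a) {θ : ATParam M O q p} (hθ : A.IsIncreasing θ) :
    IsTransform A.Ξ (fun (w : 𝒳 × (Fin p → ℝ)) y => A.h θ w.1 w.2 y)
      (fun w y => A.slope θ w.1 y) where
  isOpen := A.isOpen_Ξ
  ordConnected := A.ordConnected_Ξ
  measurable := measurable_h ha θ
  measurable_deriv := (A.measurable_slope θ).comp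
    ((measurable_fst.comp measurable_fst).prodMk measurable_snd)
  hasDerivAt _ _ hy := A.hasDerivAt_h θ _ _ hy
  deriv_pos _ _ hy := A.slope_pos hθ _ hy

/-- As the parameter lies in the interior of a compact set of increasing transformations, its slope
dominates all slopes of that set. -/
theorem exists_slope_le {Θ : Set (ATParam M O q p)} (hΘ : IsCompact Θ)
    (hincr : ∀ θ ∈ Θ, A.IsIncreasing θ) {θ₀ : ATParam M O q p} (hθ₀ : θ₀ ∈ interior Θ) :
    ∃ C > 0, ∀ θ ∈ Θ, ∀ x, ∀ y ∈ A.Ξ, A.slope θ x y ≤ C * A.slope θ₀ x y := by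
  -- By compactness one s > 0 serves all θ in Θ: the segment from θ to θ₀ can be prolonged past θ₀
  -- by the factor s inside Θ. The slope is linear in Γ and positive at the new endpoint, so s ·
  -- slope θ < (1 + s) · slope θ₀.
  have hev : ∀ᶠ s in 𝓝 (0 : ℝ), ∀ θ ∈ Θ, θ₀ + s • (θ₀ - θ) ∈ interior Θ := by
    refine hΘ.eventually_forall_of_forall_eventually fun θ _ => ?_
    have hcont : Continuous fun z : ℝ × ATParam M O q p => θ₀ + z.1 • (θ₀ - z.2) := by fun_prop
    refine hcont.continuousAt.eventually_mem (isOpen_interior.mem_nhds ?_)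
    simpa using hθ₀
  obtain ⟨s, hs, hs0⟩ := ((hev.filter_mono nhdsWithin_le_nhds).and
    (self_mem_nhdsWithin : Set.Ioi (0 : ℝ) ∈ 𝓝[>] 0)).exists
  have hs0 : 0 < s := hs0
  refine ⟨(1 + s) / s, by positivity, fun θ hθ x y hy => ?_⟩
  have hpos := A.slope_pos (hincr _ (interior_subset (hs θ hθ))) x hy
  have hlin : A.slope (θ₀ + s • (θ₀ - θ)) x y =
      A.slope θ₀ x y + s * (A.slope θ₀ x y - A.slope θ x y) := by
    simp only [slope, coeff, Prod.fst_add, Prod.smul_fst, Prod.fst_sub, Matrix.add_mulVec,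
      Matrix.smul_mulVec, Matrix.sub_mulVec, Pi.add_apply, Pi.smul_apply, Pi.sub_apply,
      smul_eq_mul, ← Finset.sum_sub_distrib, Finset.mul_sum, ← Finset.sum_add_distrib]
    exact Finset.sum_congr rfl fun m _ => by ring
  rw [hlin] at hpos
  rw [div_mul_eq_mul_div, le_div_iff₀ hs0]
  linarith

/-- The model with the outcome basis set to zero off the sample space. -/
def restrictBasis (A : ATModel M O q 𝒳) : ATModel M O q 𝒳 where
  __ := A
  a := A.Ξ.indicator A.a
  a_eq y hy := by rw [Set.indicator_of_mem (A.Icc_subset hy), A.a_eq y hy]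
  contDiffOn_a := A.contDiffOn_a.congr fun y hy => Set.indicator_of_mem hy _

/-- Nothing is known about the basis off Ξ. Zero values there make the model jointly measurable, and
change nothing along a series that stays in Ξ. -/
theorem measurable_restrictBasis (A : ATModel M O q 𝒳) : Measurable A.restrictBasis.a := by
  classical
  have h0 : A.restrictBasis.a = A.Ξ.piecewise A.a 0 := (Set.piecewise_eq_indicator ..).symm
  rw [h0]
  exact A.contDiffOn_a.continuousOn.measurable_piecewise continuousOn_const
    A.isOpen_Ξ.measurableSet

theorem restrictBasis_h₁ (θ : ATParam M O q p) (x : 𝒳) {y : ℝ} (hy : y ∈ A.Ξ) :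
    A.restrictBasis.h₁ θ x y = A.h₁ θ x y := by
  have h0 : A.restrictBasis.a y = A.a y := Set.indicator_of_mem hy _
  simp only [h₁, h0]
  rfl

theorem restrictBasis_h (θ : ATParam M O q p) (x : 𝒳) {l : Fin p → ℝ} (hl : ∀ i, l i ∈ A.Ξ)
    {y : ℝ} (hy : y ∈ A.Ξ) : A.restrictBasis.h θ x l y = A.h θ x l y := by
  simp only [h, h₂, restrictBasis_h₁ θ x hy, restrictBasis_h₁ θ x (hl _)]
  rfl

theorem restrictBasis_slope (θ : ATParam M O q p) (x : 𝒳) {y : ℝ} (hy : y ∈ A.Ξ) :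
    A.restrictBasis.slope θ x y = A.slope θ x y := by
  refine (A.restrictBasis.hasDerivAt_h₁ θ x hy).unique
    ((A.hasDerivAt_h₁ θ x hy).congr_of_eventuallyEq ?_)
  filter_upwards [A.isOpen_Ξ.mem_nhds hy] with z hz
  exact restrictBasis_h₁ θ x hz

theorem restrictBasis_isIncreasing {θ : ATParam M O q p} (hθ : A.IsIncreasing θ) :
    A.restrictBasis.IsIncreasing θ := by
  intro x y hy
  rw [(A.restrictBasis.hasDerivAt_h₁ θ x hy).deriv, restrictBasis_slope (A := A) θ x hy]
  exact A.slope_pos hθ x hy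

end ATModel

/-! ### Windows of a stationary series -/

section Window

variable {𝒳 Ω : Type*} {p : ℕ} {Y : ℕ → Ω → ℝ} {X : ℕ → Ω → 𝒳}

/-- The features and lags of the observation with index `p + n`. -/
def covariates (p : ℕ) (Y : ℕ → Ω → ℝ) (X : ℕ → Ω → 𝒳) (n : ℕ) (ω : Ω) : 𝒳 × (Fin p → ℝ) :=
  (X (p + n) ω, fun i => Y (p + n - 1 - i) ω)

/-- The observation with index `p + n`, with its features and lags. -/
def window (p : ℕ) (Y : ℕ → Ω → ℝ) (X : ℕ → Ω → 𝒳) (n : ℕ) (ω : Ω) : (𝒳 × (Fin p → ℝ)) × ℝ :=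
  (covariates p Y X n ω, Y (p + n) ω)

/-- The first window of a path. -/
def pathWindow (p : ℕ) (z : ℕ → ℝ × 𝒳) : (𝒳 × (Fin p → ℝ)) × ℝ :=
  (((z p).2, fun i => (z (p - 1 - i)).1), (z p).1)

theorem iterate_shift {S : Type*} (n : ℕ) (z : ℕ → S) (k : ℕ) :
    (fun (z : ℕ → S) (n : ℕ) => z (n + 1))^[n] z k = z (k + n) := by
  induction n generalizing z k with
  | zero => rfl
  | succ n ih => rw [Function.iterate_succ_apply, ih, add_assoc, add_comm n 1]

theorem pathWindow_iterate_shift (n : ℕ) (ω : Ω) :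
    pathWindow p ((fun (z : ℕ → ℝ × 𝒳) (n : ℕ) => z (n + 1))^[n] fun t => (Y t ω, X t ω)) =
      window p Y X n ω := by
  simp only [pathWindow, window, covariates, iterate_shift]
  refine Prod.ext (Prod.ext rfl (funext fun i => ?_)) rfl
  have hi := i.2
  dsimp only
  congr 1
  omega

variable [MeasurableSpace 𝒳] [MeasurableSpace Ω] {μ : Measure Ω}

theorem measurable_pathWindow : Measurable (pathWindow p : (ℕ → ℝ × 𝒳) → _) := by
  refine Measurable.prodMk (Measurable.prodMk ?_ ?_) ?_
  · exact measurable_snd.comp (measurable_pi_apply p)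
  · exact measurable_pi_iff.2 fun i => measurable_fst.comp (measurable_pi_apply _)
  · exact measurable_fst.comp (measurable_pi_apply p)

theorem measurable_covariates (hY : ∀ t, Measurable (Y t)) (hX : ∀ t, Measurable (X t)) (n : ℕ) :
    Measurable (covariates p Y X n) :=
  (hX _).prodMk (measurable_pi_iff.2 fun _ => hY _)

theorem measurable_window (hY : ∀ t, Measurable (Y t)) (hX : ∀ t, Measurable (X t)) (n : ℕ) :
    Measurable (window p Y X n) :=
  (measurable_covariates hY hX n).prodMk (hY _)

theorem measurable_path (hY : ∀ t, Measurable (Y t)) (hX : ∀ t, Measurable (X t)) :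
    Measurable fun ω (t : ℕ) => (Y t ω, X t ω) :=
  measurable_pi_iff.2 fun t => (hY t).prodMk (hX t)

theorem map_iterate_shift (hstat : IsStationaryErgodic (fun t ω => (Y t ω, X t ω)) μ)
    (hY : ∀ t, Measurable (Y t)) (hX : ∀ t, Measurable (X t)) {β : Type*} [MeasurableSpace β]
    {F : (ℕ → ℝ × 𝒳) → β} (hF : Measurable F) (n : ℕ) :
    μ.map (fun ω => F ((fun (z : ℕ → ℝ × 𝒳) (n : ℕ) => z (n + 1))^[n] fun t => (Y t ω, X t ω))) =
      μ.map fun ω => F fun t => (Y t ω, X t ω) := by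
  have hp := measurable_path hY hX
  have hit := hstat.toMeasurePreserving.iterate n
  have h1 := congrArg (fun m => Measure.map F m) hit.map_eq
  rw [Measure.map_map hit.measurable hp, Measure.map_map hF (hit.measurable.comp hp),
    Measure.map_map hF hp] at h1
  exact h1

theorem map_window (hstat : IsStationaryErgodic (fun t ω => (Y t ω, X t ω)) μ)
    (hY : ∀ t, Measurable (Y t)) (hX : ∀ t, Measurable (X t)) (n : ℕ) :
    μ.map (window p Y X n) = μ.map (window p Y X 0) := by
  have h1 := map_iterate_shift hstat hY hX (measurable_pathWindow (p := p)) n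
  simp only [pathWindow_iterate_shift] at h1
  rw [h1]
  congr 1

theorem map_covariates (hstat : IsStationaryErgodic (fun t ω => (Y t ω, X t ω)) μ)
    (hY : ∀ t, Measurable (Y t)) (hX : ∀ t, Measurable (X t)) (n : ℕ) :
    μ.map (covariates p Y X n) = μ.map (covariates p Y X 0) := by
  have h1 := congrArg (fun m => Measure.map Prod.fst m) (map_window (p := p) hstat hY hX n)
  rwa [Measure.map_map measurable_fst (measurable_window hY hX _),
    Measure.map_map measurable_fst (measurable_window hY hX _)] at h1

/-- The sums of a function of the windows that has negative mean tend to `-∞`. -/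
theorem ae_tendsto_sum_window_atBot [IsProbabilityMeasure μ]
    (hstat : IsStationaryErgodic (fun t ω => (Y t ω, X t ω)) μ)
    (hY : ∀ t, Measurable (Y t)) (hX : ∀ t, Measurable (X t))
    {G : (𝒳 × (Fin p → ℝ)) × ℝ → ℝ} (hG : Measurable G)
    (hint : Integrable G (μ.map (window p Y X 0)))
    (hneg : ∫ v, G v ∂(μ.map (window p Y X 0)) < 0) :
    ∀ᵐ ω ∂μ, Tendsto (fun n => ∑ k ∈ Finset.range n, G (window p Y X k ω)) atTop atBot := by
  have hp := measurable_path hY hX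
  have : IsProbabilityMeasure (μ.map fun ω (t : ℕ) => (Y t ω, X t ω)) :=
    Measure.isProbabilityMeasure_map hp.aemeasurable
  have hmap : μ.map (window p Y X 0) =
      (μ.map fun ω (t : ℕ) => (Y t ω, X t ω)).map (pathWindow p) := by
    rw [Measure.map_map measurable_pathWindow hp]
    congr 1
  rw [hmap] at hint hneg
  rw [integral_map measurable_pathWindow.aemeasurable hG.aestronglyMeasurable] at hneg
  have h1 := ae_tendsto_birkhoffSum_atBot (g := fun z => G (pathWindow p z)) hstat
    (hG.comp measurable_pathWindow) (hint.comp_measurable measurable_pathWindow) hneg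
  have h2 := ae_of_ae_map hp.aemeasurable h1
  filter_upwards [h2] with ω hω
  simpa only [birkhoffSum, pathWindow_iterate_shift] using hω

end Window

/-- A combination of Bernstein polynomials that is constant has constant coefficients. -/
theorem eq_of_sum_bernsteinBasis_eq {M : ℕ} {lo hi c : ℝ} (hlt : lo < hi) {γ : Fin (M + 1) → ℝ}
    (h : ∀ y ∈ Set.Icc lo hi, ∑ m, bernsteinBasis M lo hi y m * γ m = c) (m : Fin (M + 1)) :
    γ m = c := by
  have hd : 0 < hi - lo := sub_pos.2 hlt
  -- Substitute s = u / (1 + u) and multiply by (1 + u)^M. The Bernstein basis becomes `M.choose m *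
  -- u ^ m`; as the basis sums to one, c can be subtracted from every coefficient, so `Q` vanishes
  -- on all u > 0.
  set Q : Polynomial ℝ :=
    ∑ m : Fin (M + 1), Polynomial.monomial (m : ℕ) ((γ m - c) * (M.choose m : ℝ)) with hQ
  have hQ0 : Q = 0 := by
    refine Polynomial.eq_zero_of_infinite_isRoot Q ((Set.Ioi_infinite (0 : ℝ)).mono ?_)
    intro u hu
    have hu0 : 0 < u := hu
    have h1u : 0 < 1 + u := by positivity
    have hmem : lo + (hi - lo) * (u / (1 + u)) ∈ Set.Icc lo hi := by
      have h1 : 0 ≤ u / (1 + u) := by positivity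
      have h2 : u / (1 + u) ≤ 1 := (div_le_one h1u).2 (by linarith)
      constructor <;> nlinarith
    have hs : (lo + (hi - lo) * (u / (1 + u)) - lo) / (hi - lo) = u / (1 + u) := by
      field_simp
      ring
    have h1 := h _ hmem
    have hb : ∀ m : Fin (M + 1), bernsteinBasis M lo hi (lo + (hi - lo) * (u / (1 + u))) m *
        (1 + u) ^ M = M.choose m * u ^ (m : ℕ) := by
      intro m
      have hm : (m : ℕ) ≤ M := Nat.lt_succ_iff.1 m.2
      have h3 : 1 - u / (1 + u) = 1 / (1 + u) := by field_simp; ring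
      rw [bernsteinBasis, hs]
      simp only [bernsteinPolynomial, Polynomial.eval_mul, Polynomial.eval_natCast,
        Polynomial.eval_pow, Polynomial.eval_X, Polynomial.eval_sub, Polynomial.eval_one, h3]
      have hpow : (1 + u) ^ M = (1 + u) ^ (m : ℕ) * (1 + u) ^ (M - m) := by
        rw [← pow_add, Nat.add_sub_of_le hm]
      rw [div_pow, div_pow, one_pow, hpow]
      field_simp
    have hone : ∑ m, bernsteinBasis M lo hi (lo + (hi - lo) * (u / (1 + u))) m = 1 := by
      simp only [bernsteinBasis]
      rw [← Polynomial.eval_finsetSum,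
        ← Finset.sum_range (fun k => bernsteinPolynomial ℝ M k), bernsteinPolynomial.sum,
        Polynomial.eval_one]
    change Polynomial.eval u Q = 0
    rw [hQ, Polynomial.eval_finsetSum]
    calc ∑ m : Fin (M + 1), Polynomial.eval u
          (Polynomial.monomial (m : ℕ) ((γ m - c) * (M.choose m : ℝ)))
        = ∑ m, (γ m - c) * (bernsteinBasis M lo hi (lo + (hi - lo) * (u / (1 + u))) m *
            (1 + u) ^ M) := by
          refine Finset.sum_congr rfl fun m _ => ?_
          rw [Polynomial.eval_monomial, hb]
          ring
      _ = (∑ m, bernsteinBasis M lo hi (lo + (hi - lo) * (u / (1 + u))) m * γ m -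
            c * ∑ m, bernsteinBasis M lo hi (lo + (hi - lo) * (u / (1 + u))) m) *
            (1 + u) ^ M := by
          rw [Finset.mul_sum, ← Finset.sum_sub_distrib, Finset.sum_mul]
          exact Finset.sum_congr rfl fun m _ => by ring
      _ = 0 := by rw [h1, hone]; ring
  have hcoef := congrArg (fun P => Polynomial.coeff P (m : ℕ)) hQ0
  simp only [hQ, Polynomial.finsetSum_coeff, Polynomial.coeff_monomial, Polynomial.coeff_zero,
    Fin.val_inj, Finset.sum_ite_eq', Finset.mem_univ, if_true] at hcoef
  have hch : (M.choose m : ℝ) ≠ 0 :=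
    Nat.cast_ne_zero.2 (Nat.choose_pos (Nat.lt_succ_iff.1 m.2)).ne'
  exact sub_eq_zero.1 ((mul_eq_zero.1 hcoef).resolve_right hch)

/-- Abel summation. When the `ψ k` sum to zero only differences of consecutive terms survive, which
will turn the latent outcome into an increment of a stationary sequence. -/
theorem sum_range_succ_mul_eq (ψ a : ℕ → ℝ) (n : ℕ) :
    ∑ k ∈ Finset.range (n + 1), ψ k * a k = (∑ k ∈ Finset.range (n + 1), ψ k) * a n +
      ∑ k ∈ Finset.range n, (∑ j ∈ Finset.range (k + 1), ψ j) * (a k - a (k + 1)) := by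
  induction n with
  | zero => simp
  | succ n ih =>
    rw [Finset.sum_range_succ, ih, Finset.sum_range_succ ψ (n + 1),
      Finset.sum_range_succ
        (fun k => (∑ j ∈ Finset.range (k + 1), ψ j) * (a k - a (k + 1))) n]
    ring

theorem history_le {𝒳 Ω : Type*} [MeasurableSpace 𝒳] [m0 : MeasurableSpace Ω] {Y : ℕ → Ω → ℝ}
    {X : ℕ → Ω → 𝒳} (hY : ∀ t, Measurable (Y t)) (hX : ∀ t, Measurable (X t)) (t : ℕ) :
    history Y X t ≤ m0 :=
  sup_le (iSup₂_le fun s _ => (hY s).comap_le) (iSup₂_le fun s _ => (hX s).comap_le)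

/-- The model conditions on the whole past. Events of the first covariates belong to that past, so
the conditional distribution function may be integrated over them. -/
theorem measurable_covariates_history {𝒳 Ω : Type*} [MeasurableSpace 𝒳] {p : ℕ}
    (Y : ℕ → Ω → ℝ) (X : ℕ → Ω → 𝒳) : Measurable[history Y X p] (covariates p Y X 0) := by
  have h1 : Measurable[history Y X p] (X (p + 0)) := by
    refine Measurable.mono (comap_measurable (X p)) ?_ le_rfl
    exact le_sup_of_le_right (le_iSup₂_of_le p le_rfl le_rfl)
  have h2 : Measurable[history Y X p] fun ω (i : Fin p) => Y (p + 0 - 1 - i) ω := by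
    refine @measurable_pi_iff _ _ _ (history Y X p) _ _ |>.2 fun i => ?_
    have hi := i.2
    refine Measurable.mono (comap_measurable (Y (p + 0 - 1 - i))) ?_ le_rfl
    exact le_sup_of_le_left (le_iSup₂_of_le (p + 0 - 1 - i) (by omega) le_rfl)
  exact h1.prodMk h2

/-! ### Law of a window and identification of the parameter -/

namespace ATModel

variable {M O q p : ℕ} {𝒳 Ω : Type*} [MeasurableSpace 𝒳] [MeasurableSpace Ω]
  {μ : Measure Ω} {A : ATModel M O q 𝒳} {Y : ℕ → Ω → ℝ} {X : ℕ → Ω → 𝒳}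

/-- The link to the uniqueness hypothesis: stationarity carries agreement of the transformations
from the first covariates to those at every time. -/
theorem isTrueParam_of_ae_eq (hstat : IsStationaryErgodic (fun t ω => (Y t ω, X t ω)) μ)
    (hY : ∀ t, Measurable (Y t)) (hX : ∀ t, Measurable (X t))
    (hΞ : ∀ t, ∀ᵐ ω ∂μ, Y t ω ∈ A.Ξ) {θ θ₀ : ATParam M O q p}
    (htrue : A.IsTrueParam μ Y X θ₀)
    (heq : ∀ᵐ w ∂(μ.map (covariates p Y X 0)), ∀ y ∈ A.Ξ,
      A.restrictBasis.h θ w.1 w.2 y = A.restrictBasis.h θ₀ w.1 w.2 y) :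
    A.IsTrueParam μ Y X θ := by
  intro t ht y hy
  obtain ⟨n, rfl⟩ := Nat.exists_eq_add_of_le ht
  rw [← map_covariates hstat hY hX n] at heq
  have hall : ∀ᵐ ω ∂μ, ∀ t, Y t ω ∈ A.Ξ := ae_all_iff.2 hΞ
  filter_upwards [htrue (p + n) ht y hy, hall,
    ae_of_ae_map (measurable_covariates hY hX n).aemeasurable heq] with ω h1 h2 h3
  have h4 := h3 y hy
  rw [covariates, restrictBasis_h _ _ (fun i => h2 _) hy,
    restrictBasis_h _ _ (fun i => h2 _) hy] at h4
  rw [h1, h4]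

variable [IsProbabilityMeasure μ]

/-- The joint law of covariates and outcome in the model with basis set to zero off `Ξ`. -/
theorem map_window_eq_jointLaw (hY : ∀ t, Measurable (Y t)) (hX : ∀ t, Measurable (X t))
    (hΞ : ∀ t, ∀ᵐ ω ∂μ, Y t ω ∈ A.Ξ) {θ : ATParam M O q p} (hincr : A.IsIncreasing θ)
    (htrue : A.IsTrueParam μ Y X θ) :
    μ.map (window p Y X 0) = IsTransform.jointLaw (μ.map (covariates p Y X 0)) A.Ξ A.f
      (fun w y => A.restrictBasis.h θ w.1 w.2 y) (fun w y => A.restrictBasis.slope θ w.1 y) := by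
  have hT := isTransform (measurable_restrictBasis A) (restrictBasis_isIncreasing hincr)
  refine IsTransform.map_prodMk_eq_jointLaw (Ξ := A.Ξ) hT A.isBaseDensity
    (measurable_covariates hY hX 0) (hY _) (hΞ _) fun y hy B hB => ?_
  have hle := history_le hY hX p
  have hs : MeasurableSet {ω | Y p ω ≤ y} := measurableSet_le (hY p) measurable_const
  have hint : Integrable (Set.indicator {ω | Y p ω ≤ y} fun _ => (1 : ℝ)) μ :=
    (integrable_const 1).indicator hs
  have h1 := setIntegral_condExp hle hint (measurable_covariates_history Y X hB)
  rw [setIntegral_indicator hs] at h1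
  simp only [integral_const, smul_eq_mul, mul_one, measureReal_restrict_apply_univ] at h1
  refine h1.symm.trans (integral_congr_ae (ae_restrict_of_ae ?_))
  have hall : ∀ᵐ ω ∂μ, ∀ t, Y t ω ∈ A.Ξ := ae_all_iff.2 hΞ
  filter_upwards [htrue p le_rfl y hy, hall] with ω h2 h3
  rw [h2, baseCDF, covariates, restrictBasis_h _ _ (fun i => h3 _) hy]
  rfl

/-- In a stationary series whose model does not use features, the autoregressive coefficients do
not sum to `-1`. -/
theorem one_add_sum_ne_zero (ha : Measurable A.a) (hnf : A.NoFeatures)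
    (hstat : IsStationaryErgodic (fun t ω => (Y t ω, X t ω)) μ)
    (hY : ∀ t, Measurable (Y t)) (hX : ∀ t, Measurable (X t))
    {θ₀ : ATParam M O q p} (hincr : A.IsIncreasing θ₀)
    (hlaw : μ.map (window p Y X 0) = IsTransform.jointLaw (μ.map (covariates p Y X 0)) A.Ξ A.f
      (fun w y => A.h θ₀ w.1 w.2 y) (fun w y => A.slope θ₀ w.1 y)) :
    1 + ∑ i, θ₀.2.1 i ≠ 0 := by
  intro hsum
  have hT := isTransform ha hincr
  have hcov := measurable_covariates (p := p) hY hX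
  have hwin := measurable_window (p := p) hY hX
  have hνp : IsProbabilityMeasure (μ.map (covariates p Y X 0)) :=
    Measure.isProbabilityMeasure_map (hcov 0).aemeasurable
  have hJp : IsProbabilityMeasure (μ.map (window p Y X 0)) :=
    Measure.isProbabilityMeasure_map (hwin 0).aemeasurable
  have hone : IsTransform.jointLaw (μ.map (covariates p Y X 0)) A.Ξ A.f
      (fun w y => A.h θ₀ w.1 w.2 y) (fun w y => A.slope θ₀ w.1 y) Set.univ = 1 := by
    rw [← hlaw]
    exact measure_univ
  have hprod := hT.map_jointLaw A.isBaseDensity hone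
  rw [← hlaw, Measure.map_map (measurable_fst.prodMk hT.measurable) (hwin 0)] at hprod
  set Z : Ω → ℝ := fun ω => A.h θ₀ (X p ω) (fun i => Y (p - 1 - i) ω) (Y p ω) with hZdef
  have hZ : Measurable Z := hT.measurable.comp (hwin 0)
  have hprod' : μ.map (fun ω => (covariates p Y X 0 ω, Z ω)) =
      (μ.map (covariates p Y X 0)).prod (volume.withDensity fun z => ENNReal.ofReal (A.f z)) :=
    hprod
  have hfp : IsProbabilityMeasure (volume.withDensity fun z => ENNReal.ofReal (A.f z)) :=
    ⟨by rw [withDensity_apply _ .univ, Measure.restrict_univ, A.isBaseDensity.lintegral_eq_one]⟩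
  have hmapZ : μ.map Z = volume.withDensity fun z => ENNReal.ofReal (A.f z) := by
    have h1 := congrArg (fun m => Measure.map Prod.snd m) hprod'
    rw [Measure.map_map measurable_snd ((hcov 0).prodMk hZ), Measure.map_snd_prod] at h1
    simpa using! h1
  have hind : ProbabilityTheory.IndepFun (covariates p Y X 0) Z μ := by
    rw [ProbabilityTheory.indepFun_iff_map_prod_eq_prod_map_map (hcov 0).aemeasurable
      hZ.aemeasurable, hmapZ]
    exact hprod'
  have hconst : ∀ x x' y, A.h₁ θ₀ x y = A.h₁ θ₀ x' y := by
    intro x x' y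
    have hb : A.b x = A.b x' := funext fun o => (hnf.2.1 x o).trans (hnf.2.1 x' o).symm
    simp only [h₁, coeff, hb]
  obtain ⟨ω₀⟩ : Nonempty Ω := nonempty_of_isProbabilityMeasure μ
  set g : ℝ → ℝ := A.h₁ θ₀ (X 0 ω₀) with hg
  have hgm : Measurable g := (measurable_h₁ ha θ₀).comp measurable_prodMk_left
  -- `ψ` = (1, φ₁, …, φ_p) lists the coefficients of `Z` on `g` of the outcome and its lags, and `Ψ`
  -- their partial sums. Under the assumption `Ψ p = 0`, summation by parts gives Z = V₁ - V₀, where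
  -- Vₙ is `v` at the covariates of window n.
  let φ : ℕ → ℝ := fun i => if hi : i < p then θ₀.2.1 ⟨i, hi⟩ else 0
  let ψ : ℕ → ℝ := fun k => Nat.casesOn k 1 φ
  let Ψ : ℕ → ℝ := fun k => ∑ j ∈ Finset.range (k + 1), ψ j
  have hφ : ∀ i : Fin p, φ i = θ₀.2.1 i := fun i => dif_pos i.2
  have hΨ : Ψ p = 0 := by
    rw [← hsum]
    change ∑ j ∈ Finset.range (p + 1), ψ j = _
    rw [Finset.sum_range_succ', Finset.sum_range, add_comm]
    congr 1
    exact Finset.sum_congr rfl fun i _ => hφ i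
  let v : 𝒳 × (Fin p → ℝ) → ℝ := fun w => ∑ k : Fin p, Ψ k * g (w.2 k)
  have hv : Measurable v := Finset.measurable_fun_sum _ fun k _ =>
    (hgm.comp ((measurable_pi_apply k).comp measurable_snd)).const_mul _
  have hZv : ∀ ω, v (covariates p Y X 0 ω) + Z ω = v (covariates p Y X 1 ω) := by
    intro ω
    have h1 : Z ω = ∑ k ∈ Finset.range (p + 1), ψ k * g (Y (p - k) ω) := by
      rw [Finset.sum_range_succ', Finset.sum_range, hZdef]
      simp only [h, h₂, hnf.2.2.2, hconst (X p ω) (X 0 ω₀), add_zero]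
      rw [add_comm]
      congr 1
      · refine Finset.sum_congr rfl fun i _ => ?_
        rw [← hφ i, Nat.sub_sub, add_comm 1]
      · simp [ψ, hg]
    rw [h1, sum_range_succ_mul_eq, show ∑ k ∈ Finset.range (p + 1), ψ k = 0 from hΨ, zero_mul,
      zero_add, Finset.sum_range]
    simp only [v, covariates, ← Finset.sum_add_distrib]
    refine Finset.sum_congr rfl fun k _ => ?_
    have hk := k.2
    have e1 : p + 0 - 1 - (k : ℕ) = p - (k + 1) := by omega
    have e2 : p + 1 - 1 - (k : ℕ) = p - k := by omega
    rw [e1, e2]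
    ring
  refine false_of_map_add_eq (V := fun ω => v (covariates p Y X 0 ω)) (hv.comp (hcov 0)) hZ
    (hind.comp hv measurable_id) ?_ ?_
  · simp_rw [hZv]
    have h1 := congrArg (fun m => Measure.map v m) (map_covariates (p := p) hstat hY hX 1)
    rwa [Measure.map_map hv (hcov 1), Measure.map_map hv (hcov 0)] at h1
  · rw [hmapZ]
    exact withDensity_absolutelyContinuous _ _

/-- No nontrivial linear relation holds between the transformed lags. -/
theorem eq_zero_of_sum_lags_eq
    (hstat : IsStationaryErgodic (fun t ω => (Y t ω, X t ω)) μ)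
    (hY : ∀ t, Measurable (Y t)) (hX : ∀ t, Measurable (X t))
    {θ₀ : ATParam M O q p}
    (hlaw : μ.map (window p Y X 0) = IsTransform.jointLaw (μ.map (covariates p Y X 0)) A.Ξ A.f
      (fun w y => A.h θ₀ w.1 w.2 y) (fun w y => A.slope θ₀ w.1 y))
    {g : ℝ → ℝ} (hg : Measurable g) (hginj : Set.InjOn g A.Ξ) {δ : Fin p → ℝ} {c : ℝ}
    (hrel : ∀ᵐ w ∂(μ.map (covariates p Y X 0)), ∑ i, δ i * g (w.2 i) = c) : δ = 0 := by
  by_contra hne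
  have hex : ∃ n : ℕ, ∃ hn : n < p, δ ⟨n, hn⟩ ≠ 0 := by
    obtain ⟨i, hi⟩ := Function.ne_iff.1 hne
    exact ⟨i, i.2, hi⟩
  classical
  obtain ⟨n, ⟨hn, hδ⟩, hmin'⟩ : ∃ n : ℕ, (∃ hn : n < p, δ ⟨n, hn⟩ ≠ 0) ∧
      ∀ m < n, ¬ ∃ hm : m < p, δ ⟨m, hm⟩ ≠ 0 :=
    ⟨Nat.find hex, Nat.find_spec hex, fun m => Nat.find_min hex⟩
  have hmin : ∀ i : Fin p, (i : ℕ) < n → δ i = 0 := by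
    intro i hi
    by_contra hcon
    exact hmin' i hi ⟨i.2, hcon⟩
  have hcov := measurable_covariates (p := p) hY hX
  have hwin := measurable_window (p := p) hY hX
  have hνp : IsProbabilityMeasure (μ.map (covariates p Y X 0)) :=
    Measure.isProbabilityMeasure_map (hcov 0).aemeasurable
  -- `n` indexes the most recent lag in the relation. Shifted by n + 1 steps, the relation has the
  -- outcome `Y p` in that position, and older lags `i` become lags `i - n - 1` of the first window.
  -- Solving for `g (Y p)` makes it a function of the covariates, an event of probability zero.
  let k : 𝒳 × (Fin p → ℝ) → ℝ := fun w => (c - ∑ i : Fin p, if hi : n < (i : ℕ) then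
    δ i * g (w.2 ⟨i - n - 1, by omega⟩) else 0) / δ ⟨n, hn⟩
  have hk : Measurable k := by
    refine (measurable_const.sub (Finset.measurable_fun_sum _ fun i _ => ?_)).div_const _
    by_cases hi : n < (i : ℕ)
    · simp only [hi, dif_pos]
      exact (hg.comp ((measurable_pi_apply _).comp measurable_snd)).const_mul _
    · simp only [hi, dif_neg, not_false_eq_true]
      exact measurable_const
  have h0 := IsTransform.jointLaw_graph_eq_zero (ν := μ.map (covariates p Y X 0)) (f := A.f)
    (H := fun w y => A.h θ₀ w.1 w.2 y) (D := fun w y => A.slope θ₀ w.1 y) hg hginj hk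
  rw [← hlaw] at h0
  rw [← map_covariates hstat hY hX (n + 1)] at hrel
  have h1 := ae_of_ae_map (hcov (n + 1)).aemeasurable hrel
  have h2 := ae_of_ae_map (hwin 0).aemeasurable (measure_eq_zero_iff_ae_notMem.1 h0)
  obtain ⟨ω, hω1, hω2⟩ := (h1.and h2).exists
  apply hω2
  change g (Y p ω) = k (covariates p Y X 0 ω)
  rw [eq_div_iff hδ, eq_sub_iff_add_eq, ← hω1]
  have hsplit : ∀ i : Fin p, δ i * g ((covariates p Y X (n + 1) ω).2 i) =
      (if i = ⟨n, hn⟩ then g (Y p ω) * δ ⟨n, hn⟩ else 0) + if hi : n < (i : ℕ) then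
        δ i * g ((covariates p Y X 0 ω).2 ⟨i - n - 1, by omega⟩) else 0 := by
    intro i
    have hip := i.2
    rcases lt_trichotomy (i : ℕ) n with hi | hi | hi
    · rw [hmin i hi, if_neg (fun hcon => by rw [hcon] at hi; exact lt_irrefl _ hi),
        dif_neg (not_lt.2 hi.le)]
      simp
    · have hi' : i = ⟨n, hn⟩ := Fin.ext hi
      rw [if_pos hi', dif_neg (not_lt.2 hi.le), add_zero, hi', mul_comm]
      have e : p + (n + 1) - 1 - n = p := by omega
      simp only [covariates, e]
    · rw [if_neg (fun hcon => by rw [hcon] at hi; exact lt_irrefl _ hi), dif_pos hi, zero_add]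
      have e : p + (n + 1) - 1 - (i : ℕ) = p + 0 - 1 - (i - n - 1) := by omega
      simp only [covariates, e]
  rw [Finset.sum_congr rfl fun i _ => hsplit i, Finset.sum_add_distrib, Finset.sum_ite_eq']
  simp

/-- A model that does not use features is identified. -/
theorem eq_of_noFeatures (ha : Measurable A.a) (hnf : A.NoFeatures)
    (hstat : IsStationaryErgodic (fun t ω => (Y t ω, X t ω)) μ)
    (hY : ∀ t, Measurable (Y t)) (hX : ∀ t, Measurable (X t)) (hΞ : ∀ t, ∀ᵐ ω ∂μ, Y t ω ∈ A.Ξ)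
    {θ θ₀ : ATParam M O q p} (hincr : A.IsIncreasing θ₀)
    (hlaw : μ.map (window p Y X 0) = IsTransform.jointLaw (μ.map (covariates p Y X 0)) A.Ξ A.f
      (fun w y => A.h θ₀ w.1 w.2 y) (fun w y => A.slope θ₀ w.1 y))
    (heq : ∀ᵐ w ∂(μ.map (covariates p Y X 0)), ∀ y ∈ A.Ξ,
      A.h θ w.1 w.2 y = A.h θ₀ w.1 w.2 y) : θ = θ₀ := by
  have hsum := one_add_sum_ne_zero ha hnf hstat hY hX hincr hlaw
  obtain ⟨rfl, hb, rfl, hr⟩ := hnf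
  have hcov := measurable_covariates (p := p) hY hX
  have hνp : IsProbabilityMeasure (μ.map (covariates p Y X 0)) :=
    Measure.isProbabilityMeasure_map (hcov 0).aemeasurable
  have hcoeff : ∀ (ϑ : ATParam M 1 0 p) x m, A.coeff ϑ x m = ϑ.1 m 0 := by
    intro ϑ x m
    simp [coeff, Matrix.mulVec, dotProduct, hb]
  obtain ⟨ω₀⟩ : Nonempty Ω := nonempty_of_isProbabilityMeasure μ
  have hconst : ∀ (ϑ : ATParam M 1 0 p) x y, A.h₁ ϑ x y = A.h₁ ϑ (X 0 ω₀) y := by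
    intro ϑ x y
    simp only [h₁, hcoeff]
  have hloΞ : A.lo ∈ A.Ξ := A.Icc_subset (Set.left_mem_Icc.2 A.lo_lt_hi.le)
  set g : ℝ → ℝ := A.h₁ θ₀ (X 0 ω₀) with hg
  have hgm : Measurable g := (measurable_h₁ ha θ₀).comp measurable_prodMk_left
  have hginj : Set.InjOn g A.Ξ := by
    have hmono := (isTransform ha hincr).strictMonoOn (X 0 ω₀, fun _ => 0)
    intro y hy y' hy' hyy
    refine hmono.injOn hy hy' ?_
    simp only [h]
    rw [← hg, hyy]
  set c := A.h₁ θ (X 0 ω₀) A.lo - g A.lo with hc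
  -- The lag terms do not depend on y, so comparing y with `A.lo` at a single good `w` removes them.
  have hdiff : ∀ y ∈ A.Ξ, A.h₁ θ (X 0 ω₀) y = g y + c := by
    obtain ⟨w, hw⟩ := heq.exists
    intro y hy
    have h1 := hw y hy
    have h2 := hw A.lo hloΞ
    simp only [h, hconst _ w.1] at h1 h2
    rw [hc]
    linarith
  have hΓ : ∀ m, θ.1 m 0 - θ₀.1 m 0 = c := by
    refine eq_of_sum_bernsteinBasis_eq A.lo_lt_hi fun y hy => ?_
    have h1 := hdiff y (A.Icc_subset hy)
    simp only [hg, h₁, hcoeff] at h1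
    rw [← A.a_eq y hy]
    simp only [mul_sub, Finset.sum_sub_distrib, h1, add_sub_cancel_left]
  have hmem : ∀ᵐ w ∂(μ.map (covariates p Y X 0)), ∀ i, w.2 i ∈ A.Ξ := by
    rw [ae_map_iff (hcov 0).aemeasurable]
    · exact ae_all_iff.2 fun i => hΞ _
    · refine MeasurableSet.congr (s := ⋂ i, {w : 𝒳 × (Fin p → ℝ) | w.2 i ∈ A.Ξ}) ?_
        (by ext; simp)
      exact MeasurableSet.iInter fun i =>
        ((measurable_pi_apply i).comp measurable_snd) A.isOpen_Ξ.measurableSet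
  -- Equality of the transformations at `A.lo`, with h₁ under `θ` replaced by `g + c` at the outcome
  -- and at each lag.
  have hrel : ∀ᵐ w ∂(μ.map (covariates p Y X 0)),
      ∑ i, (θ.2.1 i - θ₀.2.1 i) * g (w.2 i) = -(c * (1 + ∑ i, θ.2.1 i)) := by
    filter_upwards [heq, hmem] with w h1 h2
    have h3 := h1 A.lo hloΞ
    simp only [h, h₂, hr, add_zero, hconst _ w.1, hdiff _ hloΞ, hdiff _ (h2 _), ← hg] at h3
    simp only [mul_add, Finset.sum_add_distrib, ← Finset.sum_mul] at h3
    simp only [sub_mul, Finset.sum_sub_distrib]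
    linarith
  have hφ := eq_zero_of_sum_lags_eq hstat hY hX hlaw hgm hginj
    (δ := fun i => θ.2.1 i - θ₀.2.1 i) hrel
  have hφ' : ∀ i, θ.2.1 i = θ₀.2.1 i := fun i => sub_eq_zero.1 (congrFun hφ i)
  have hc0 : c = 0 := by
    obtain ⟨w, hw⟩ := hrel.exists
    simp only [hφ', sub_self, zero_mul, Finset.sum_const_zero] at hw
    have h1 : c * (1 + ∑ i, θ₀.2.1 i) = 0 := by linarith
    exact (mul_eq_zero.1 h1).resolve_right hsum
  refine Prod.ext ?_ (Prod.ext (funext hφ') (Subsingleton.elim _ _))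
  ext m o
  have h1 := hΓ m
  rw [hc0, sub_eq_zero] at h1
  rwa [Subsingleton.elim o 0]

end ATModel

/-! ### Local uniform bounds for the log-likelihood ratio -/

namespace ATModel

variable {M O q p : ℕ} {𝒳 Ω : Type*} [MeasurableSpace 𝒳] {A : ATModel M O q 𝒳} {Y : ℕ → Ω → ℝ} {X : ℕ → Ω → 𝒳}

/-- The conditional density of an observation given its features and lags. -/
def condDensity (A : ATModel M O q 𝒳) (θ : ATParam M O q p) (v : (𝒳 × (Fin p → ℝ)) × ℝ) : ℝ :=
  transformDensity A.f (fun (w : 𝒳 × (Fin p → ℝ)) y => A.h θ w.1 w.2 y)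
    (fun w y => A.slope θ w.1 y) v

theorem condDensity_pos {θ : ATParam M O q p} (hθ : A.IsIncreasing θ)
    {v : (𝒳 × (Fin p → ℝ)) × ℝ} (hv : v.2 ∈ A.Ξ) : 0 < A.condDensity θ v :=
  mul_pos (A.isBaseDensity.pos _) (A.slope_pos hθ _ hv)

theorem continuous_condDensity (A : ATModel M O q 𝒳) (v : (𝒳 × (Fin p → ℝ)) × ℝ) :
    Continuous fun θ : ATParam M O q p => A.condDensity θ v :=
  (A.isBaseDensity.continuous.comp (A.continuous_h _ _ _)).mul (A.continuous_slope _ _)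

/-- In the numerator `f` is bounded and the slope is at most a constant times the slope at `θ₀`,
which cancels. What remains depends on the latent value under `θ₀` alone. -/
theorem condDensity_div_le {Θ : Set (ATParam M O q p)} (hΘ : IsCompact Θ)
    (hincr : ∀ θ ∈ Θ, A.IsIncreasing θ) {θ₀ : ATParam M O q p} (hθ₀ : θ₀ ∈ interior Θ) :
    ∃ K > 0, ∀ θ ∈ Θ, ∀ v : (𝒳 × (Fin p → ℝ)) × ℝ, v.2 ∈ A.Ξ →
      A.condDensity θ v / A.condDensity θ₀ v ≤ K / A.f (A.h θ₀ v.1.1 v.1.2 v.2) := by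
  obtain ⟨C, hC, hslope⟩ := exists_slope_le hΘ hincr hθ₀
  obtain ⟨B, hB, hf⟩ := A.isBaseDensity.exists_le
  refine ⟨B * C, by positivity, fun θ hθ v hv => ?_⟩
  have h0 := A.slope_pos (hincr _ (interior_subset hθ₀)) v.1.1 hv
  have h1 := A.slope_pos (hincr _ hθ) v.1.1 hv
  have h2 := A.isBaseDensity.pos (A.h θ₀ v.1.1 v.1.2 v.2)
  rw [div_le_div_iff₀ (condDensity_pos (hincr _ (interior_subset hθ₀)) hv) h2]
  have h3 : A.condDensity θ v ≤ B * (C * A.slope θ₀ v.1.1 v.2) :=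
    mul_le_mul (hf _) (hslope θ hθ _ _ hv) h1.le hB.le
  calc A.condDensity θ v * A.f (A.h θ₀ v.1.1 v.1.2 v.2)
      ≤ B * (C * A.slope θ₀ v.1.1 v.2) * A.f (A.h θ₀ v.1.1 v.1.2 v.2) :=
        mul_le_mul_of_nonneg_right h3 h2.le
    _ = B * C * A.condDensity θ₀ v := by
        simp only [condDensity, transformDensity]
        ring

/-- From index `p` on, all lags are observed: the starting values drop out and the term is a
function of the window. -/
theorem logLik_term_eq {θ : ATParam M O q p} (hθ : A.IsIncreasing θ) (y₀ : Fin p → ℝ) {ω : Ω}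
    (hΞ : ∀ t, Y t ω ∈ A.Ξ) (k : ℕ) :
    Real.log (A.f (A.h θ (X (p + k) ω) (lagVector y₀ (fun t => Y t ω) (p + k)) (Y (p + k) ω))) +
      Real.log |deriv (A.h θ (X (p + k) ω) (lagVector y₀ (fun t => Y t ω) (p + k)))
        (Y (p + k) ω)| = Real.log (A.restrictBasis.condDensity θ (window p Y X k ω)) := by
  have hlag : lagVector y₀ (fun t => Y t ω) (p + k) = fun i : Fin p => Y (p + k - 1 - i) ω := by
    funext i
    have hi := i.2
    simp only [lagVector]
    rw [if_pos (by omega)]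
  have h0 := A.slope_pos hθ (X (p + k) ω) (hΞ (p + k))
  rw [hlag, (A.hasDerivAt_h θ _ _ (hΞ (p + k))).deriv, abs_of_pos h0,
    ← Real.log_mul (A.isBaseDensity.pos _).ne' h0.ne']
  simp only [condDensity, transformDensity, window, covariates]
  rw [restrictBasis_h _ _ (fun i => hΞ _) (hΞ _), restrictBasis_slope _ _ (hΞ _)]
  rfl

theorem continuousOn_sum_logLik_terms {Θ : Set (ATParam M O q p)}
    (hincr : ∀ θ ∈ Θ, A.IsIncreasing θ) (y₀ : Fin p → ℝ) (y : ℕ → ℝ) (x : ℕ → 𝒳)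
    (hΞ : ∀ t, y t ∈ A.Ξ) (T : ℕ) : ContinuousOn (A.logLik y₀ y x T) Θ := by
  have hlog : ∀ θ ∈ Θ, A.logLik y₀ y x T θ = ∑ t ∈ Finset.range T,
      (Real.log (A.f (A.h θ (x t) (lagVector y₀ y t) (y t))) +
        Real.log (A.slope θ (x t) (y t))) := fun θ hθ =>
    Finset.sum_congr rfl fun t _ => by
      rw [(A.hasDerivAt_h θ _ _ (hΞ t)).deriv, abs_of_pos (A.slope_pos (hincr θ hθ) _ (hΞ t))]
  refine ContinuousOn.congr (continuousOn_finsetSum _ fun t _ => ?_) hlog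
  refine ContinuousOn.add (Continuous.continuousOn ?_) ?_
  · exact (A.isBaseDensity.continuous.comp (A.continuous_h _ _ _)).log
      fun _ => (A.isBaseDensity.pos _).ne'
  · exact (A.continuous_slope _ _).continuousOn.log
      fun θ hθ => (A.slope_pos (hincr θ hθ) _ (hΞ t)).ne'

variable [MeasurableSpace Ω] {μ : Measure Ω} [IsProbabilityMeasure μ]

/-- Near a parameter with a different transformation, the log-likelihood ratio of the windows tends
to `-∞`, uniformly in the parameter. -/
theorem exists_isOpen_sum_log_le (ha : Measurable A.a)
    (hstat : IsStationaryErgodic (fun t ω => (Y t ω, X t ω)) μ)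
    (hY : ∀ t, Measurable (Y t)) (hX : ∀ t, Measurable (X t))
    {Θ : Set (ATParam M O q p)} (hΘ : IsCompact Θ) (hincr : ∀ θ ∈ Θ, A.IsIncreasing θ)
    {θ₀ : ATParam M O q p} (hθ₀ : θ₀ ∈ interior Θ)
    (hlaw : μ.map (window p Y X 0) = IsTransform.jointLaw (μ.map (covariates p Y X 0)) A.Ξ A.f
      (fun w y => A.h θ₀ w.1 w.2 y) (fun w y => A.slope θ₀ w.1 y))
    {θ : ATParam M O q p} (hθ : θ ∈ Θ)
    (hne : ¬ ∀ᵐ w ∂(μ.map (covariates p Y X 0)), ∀ y ∈ A.Ξ,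
      A.h θ w.1 w.2 y = A.h θ₀ w.1 w.2 y) :
    ∃ U, IsOpen U ∧ θ ∈ U ∧ ∃ S : ℕ → Ω → ℝ, ∀ᵐ ω ∂μ, Tendsto (fun n => S n ω) atTop atBot ∧
      ∀ n, ∀ θ' ∈ Θ ∩ U, ∑ k ∈ Finset.range n, (Real.log (A.condDensity θ' (window p Y X k ω)) -
        Real.log (A.condDensity θ₀ (window p Y X k ω))) ≤ S n ω := by
  have hcov := measurable_covariates (p := p) hY hX
  have hwin := measurable_window (p := p) hY hX
  have hνp : IsProbabilityMeasure (μ.map (covariates p Y X 0)) :=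
    Measure.isProbabilityMeasure_map (hcov 0).aemeasurable
  have hJp : IsProbabilityMeasure (μ.map (window p Y X 0)) :=
    Measure.isProbabilityMeasure_map (hwin 0).aemeasurable
  have hincr₀ := hincr _ (interior_subset hθ₀)
  have hT₀ := isTransform ha hincr₀
  have hone : IsTransform.jointLaw (μ.map (covariates p Y X 0)) A.Ξ A.f
      (fun w y => A.h θ₀ w.1 w.2 y) (fun w y => A.slope θ₀ w.1 y) Set.univ = 1 := by
    rw [← hlaw]
    exact measure_univ
  have hmem : ∀ᵐ v ∂(μ.map (window p Y X 0)), v.2 ∈ A.Ξ := by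
    rw [hlaw]
    exact hT₀.ae_jointLaw_mem
  obtain ⟨K, hK, hratio⟩ := condDensity_div_le hΘ hincr hθ₀
  -- The square root is essential for domination: the mean of 1 / √f(Z) is at most ∫ √f, whereas 1 /
  -- f(Z) has no finite mean.
  let ρ : ATParam M O q p → (𝒳 × (Fin p → ℝ)) × ℝ → ENNReal := fun ϑ v =>
    ENNReal.ofReal (√(A.condDensity ϑ v / A.condDensity θ₀ v))
  let g : (𝒳 × (Fin p → ℝ)) × ℝ → ENNReal := fun v =>
    ENNReal.ofReal (√K) * ENNReal.ofReal (1 / √(A.f (A.h θ₀ v.1.1 v.1.2 v.2)))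
  have hg : ∫⁻ v, g v ∂(μ.map (window p Y X 0)) ≠ ⊤ := by
    rw [lintegral_const_mul' _ _ ENNReal.ofReal_ne_top, hlaw]
    refine ENNReal.mul_ne_top ENNReal.ofReal_ne_top (ne_top_of_le_ne_top ?_
      (hT₀.lintegral_inv_sqrt_le A.isBaseDensity))
    exact A.isBaseDensity.integrable_sqrt.lintegral_lt_top.ne
  have hρg : ∀ᵐ v ∂(μ.map (window p Y X 0)), ∀ ϑ ∈ Θ, ρ ϑ v ≤ g v := by
    filter_upwards [hmem] with v hv ϑ hϑ
    dsimp only [ρ, g]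
    rw [← ENNReal.ofReal_mul (Real.sqrt_nonneg _), mul_one_div, ← Real.sqrt_div hK.le]
    exact ENNReal.ofReal_le_ofReal (Real.sqrt_le_sqrt (hratio ϑ hϑ v hv))
  obtain ⟨U, hU, hθU, σ, hσm, hσ1, hσ⟩ := exists_isOpen_lintegral_lt_one (Θ := Θ) (ρ := ρ)
    (fun ϑ hϑ => IsTransform.measurable_sqrtRatio (isTransform ha (hincr ϑ hϑ)) hT₀
      A.isBaseDensity)
    (Eventually.of_forall fun v => (ENNReal.continuous_ofReal.comp
      ((A.continuous_condDensity v).div_const _).sqrt).continuousOn) hg hρg hθ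
    (by
      rw [hlaw]
      exact IsTransform.lintegral_sqrtRatio_lt_one (isTransform ha (hincr θ hθ)) hT₀
        A.isBaseDensity hone hne)
  have hσtop : ∫⁻ v, σ v ∂(μ.map (window p Y X 0)) ≠ ⊤ := (hσ1.trans ENNReal.one_lt_top).ne
  have hσfin := ae_lt_top hσm hσtop
  have hσint := integrable_toReal_of_lintegral_ne_top hσm.aemeasurable hσtop
  -- For θ' in Θ ∩ U, log R = 2 log √R ≤ 2(√R - 1) ≤ 2(σ - 1), and the last function has negative
  -- mean.
  have hlim := ae_tendsto_sum_window_atBot hstat hY hX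
    (G := fun v => 2 * ((σ v).toReal - 1)) ((hσm.ennreal_toReal.sub_const 1).const_mul 2)
    ((hσint.sub (integrable_const 1)).const_mul 2) (by
      rw [integral_const_mul, integral_sub hσint (integrable_const 1),
        integral_toReal hσm.aemeasurable hσfin]
      have h1 : (∫⁻ v, σ v ∂(μ.map (window p Y X 0))).toReal < 1 := by
        rw [← ENNReal.toReal_one]
        exact (ENNReal.toReal_lt_toReal hσtop ENNReal.one_ne_top).2 hσ1
      simp only [integral_const, probReal_univ, smul_eq_mul, one_mul]
      linarith)
  refine ⟨U, hU, hθU, fun n ω => ∑ k ∈ Finset.range n, 2 * ((σ (window p Y X k ω)).toReal - 1), ?_⟩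
  have hgood : ∀ᵐ ω ∂μ, ∀ k, window p Y X k ω ∈ {v | v.2 ∈ A.Ξ ∧ σ v < ⊤ ∧
      ∀ θ' ∈ Θ ∩ U, ρ θ' v ≤ σ v} := by
    refine ae_all_iff.2 fun k => ae_of_ae_map (hwin k).aemeasurable ?_
    rw [map_window hstat hY hX k]
    filter_upwards [hmem, hσfin, hσ] with v h1 h2 h3
    exact ⟨h1, h2, h3⟩
  filter_upwards [hlim, hgood] with ω h1 h2
  refine ⟨h1, fun n θ' hθ' => Finset.sum_le_sum fun k _ => ?_⟩
  obtain ⟨h3, h4, h5⟩ := h2 k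
  set v := window p Y X k ω
  have hpos' := condDensity_pos (hincr θ' hθ'.1) h3
  have hpos₀ := condDensity_pos hincr₀ h3
  have hR := div_pos hpos' hpos₀
  rw [← Real.log_div hpos'.ne' hpos₀.ne', ← Real.sq_sqrt hR.le, Real.log_pow]
  have h6 := Real.log_le_sub_one_of_pos (Real.sqrt_pos.2 hR)
  have h7 : √(A.condDensity θ' v / A.condDensity θ₀ v) ≤ (σ v).toReal :=
    (ENNReal.ofReal_le_iff_le_toReal h4.ne).1 (h5 θ' hθ')
  push_cast
  linarith

end ATModel

end

/-! ### Consistency of the maximum-likelihood estimator -/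

theorem theorem1 {M O q p : ℕ} {𝒳 Ω : Type*} [MeasurableSpace 𝒳] [MeasurableSpace Ω]
    (μ : Measure Ω) [IsProbabilityMeasure μ]
    (A : ATModel M O q 𝒳)
    (Θ : Set (ATParam M O q p)) (hΘ : IsCompact Θ)
    (hincr : ∀ θ ∈ Θ, A.IsIncreasing θ)
    (θstar : ATParam M O q p) (hθstar : θstar ∈ interior Θ)
    (Y : ℕ → Ω → ℝ) (X : ℕ → Ω → 𝒳)
    (hY : ∀ t, Measurable (Y t)) (hX : ∀ t, Measurable (X t))
    (hΞ : ∀ t, ∀ᵐ ω ∂μ, Y t ω ∈ A.Ξ)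
    (hstat : IsStationaryErgodic (fun t ω => (Y t ω, X t ω)) μ)
    (htrue : A.IsTrueParam μ Y X θstar)
    (hunique : ¬ A.NoFeatures → ∀ θ ∈ Θ, A.IsTrueParam μ Y X θ → θ = θstar)
    (y₀ : Fin p → Ω → ℝ)
    (θhat : ℕ → Ω → ATParam M O q p)
    (hθhat : ∀ T, ∀ᵐ ω ∂μ,
      A.IsMLE Θ (fun i => y₀ i ω) (fun t => Y t ω) (fun t => X t ω) T (θhat T ω)) :
    ∀ᵐ ω ∂μ, Tendsto (fun T => θhat T ω) atTop (𝓝 θstar) := by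
  have hincr₀ := hincr _ (interior_subset hθstar)
  have hlaw := ATModel.map_window_eq_jointLaw hY hX hΞ hincr₀ htrue
  have ha := A.measurable_restrictBasis
  have hall : ∀ᵐ ω ∂μ, ∀ t, Y t ω ∈ A.Ξ := ae_all_iff.2 hΞ
  have hmle : ∀ᵐ ω ∂μ, ∀ T, A.IsMLE Θ (fun i => y₀ i ω) (fun t => Y t ω) (fun t => X t ω) T
      (θhat T ω) := ae_all_iff.2 hθhat
  have hlocal : ∀ θ ∈ Θ, θ ≠ θstar → ∃ U, IsOpen U ∧ θ ∈ U ∧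
      ∀ᵐ ω ∂μ, ∀ᶠ T in atTop, θhat T ω ∉ U := by
    intro θ hθ hne
    have hdiff : ¬ ∀ᵐ w ∂(μ.map (covariates p Y X 0)), ∀ y ∈ A.Ξ,
        A.restrictBasis.h θ w.1 w.2 y = A.restrictBasis.h θstar w.1 w.2 y := by
      intro heq
      apply hne
      by_cases hnf : A.NoFeatures
      · exact ATModel.eq_of_noFeatures (A := A.restrictBasis) ha hnf hstat hY hX hΞ
          (ATModel.restrictBasis_isIncreasing hincr₀) hlaw heq
      · exact hunique hnf θ hθ (ATModel.isTrueParam_of_ae_eq hstat hY hX hΞ htrue heq)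
    obtain ⟨U, hU, hθU, S, hS⟩ := ATModel.exists_isOpen_sum_log_le (A := A.restrictBasis) ha hstat
      hY hX hΘ (fun ϑ hϑ => ATModel.restrictBasis_isIncreasing (hincr ϑ hϑ)) hθstar hlaw hθ hdiff
    refine ⟨U, hU, hθU, ?_⟩
    filter_upwards [hS, hall, hmle] with ω hω hΞω hmleω
    obtain ⟨hlim, hle⟩ := hω
    let L : ℕ → ATParam M O q p → ℝ :=
      A.logLik (fun i => y₀ i ω) (fun t => Y t ω) (fun t => X t ω)
    -- The first `p` terms, the only ones containing starting values, are continuous in the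
    -- parameter and hence bounded above on Θ.
    obtain ⟨C, hC⟩ := hΘ.bddAbove_image (f := L p)
      (ATModel.continuousOn_sum_logLik_terms hincr _ _ _ hΞω p)
    have hsplit : ∀ ϑ ∈ Θ, ∀ n, L (p + n) ϑ = L p ϑ + ∑ k ∈ Finset.range n,
        Real.log (A.restrictBasis.condDensity ϑ (window p Y X k ω)) := by
      intro ϑ hϑ n
      simp only [L, ATModel.logLik]
      rw [Finset.sum_range_add]
      congr 1
      exact Finset.sum_congr rfl fun k _ => ATModel.logLik_term_eq (hincr ϑ hϑ) _ hΞω k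
    -- An estimator in `U` must do at least as well as `θstar`, so the later log-likelihood ratio is
    -- at least `L p θstar - C`; once `S` is below that level this is impossible.
    obtain ⟨N, hN⟩ := eventually_atTop.1 (hlim.eventually_lt_atBot (L p θstar - C))
    filter_upwards [eventually_ge_atTop (p + N)] with T hT hmem
    obtain ⟨n, rfl⟩ := Nat.exists_eq_add_of_le (le_trans (Nat.le_add_right p N) hT)
    have hn := hN n (by omega)
    obtain ⟨hhatΘ, hmin⟩ := hmleω (p + n)
    have h1 : L (p + n) θstar ≤ L (p + n) (θhat (p + n) ω) :=
      neg_le_neg_iff.1 (hmin (interior_subset hθstar))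
    have h2 := hle n _ ⟨hhatΘ, hmem⟩
    have h3 : L p (θhat (p + n) ω) ≤ C := hC ⟨_, hhatΘ, rfl⟩
    rw [hsplit _ hhatΘ, hsplit _ (interior_subset hθstar)] at h1
    rw [Finset.sum_sub_distrib] at h2
    linarith
  -- A countable neighbourhood basis keeps the exceptional events countable; for each `W j`,
  -- finitely many of the local neighbourhoods cover the compact set `Θ \ W j`.
  obtain ⟨W, hW, hbasis⟩ := (nhds_basis_opens θstar).exists_antitone_subbasis
  have hcompact : ∀ j, ∀ᵐ ω ∂μ, ∀ᶠ T in atTop, θhat T ω ∈ W j := by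
    intro j
    have hK : IsCompact (Θ \ W j) := hΘ.diff (hW j).2
    have hloc : ∀ θ ∈ Θ \ W j, ∃ U, IsOpen U ∧ θ ∈ U ∧
        ∀ᵐ ω ∂μ, ∀ᶠ T in atTop, θhat T ω ∉ U := fun θ hθ =>
      hlocal θ hθ.1 fun hcon => hθ.2 (hcon ▸ (hW j).1)
    choose! U hUo hUm hUev using hloc
    obtain ⟨t, ht, hcover⟩ := hK.elim_nhds_subcover U
      fun θ hθ => (hUo θ hθ).mem_nhds (hUm θ hθ)
    have hev : ∀ᵐ ω ∂μ, ∀ θ ∈ t, ∀ᶠ T in atTop, θhat T ω ∉ U θ :=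
      (ae_ball_iff t.countable_toSet).2 fun θ hθ => hUev θ (ht θ hθ)
    filter_upwards [hev, hmle] with ω h1 h2
    filter_upwards [(Filter.eventually_all_finset t).2 h1] with T hT
    by_contra hcon
    obtain ⟨θ, hθ, hmem⟩ := Set.mem_iUnion₂.1 (hcover ⟨(h2 T).1, hcon⟩)
    exact hT θ hθ hmem
  filter_upwards [ae_all_iff.2 hcompact] with ω hω
  exact hbasis.tendsto_right_iff.2 fun j _ => hω j
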